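/- **Model.** Let $X_1,X_2,\dots$ be random variables on a measurable space $(\Omega,\mathcal F)$ with values in a measurable space $\mathcal X$, let $\mu$ be a $\sigma$-finite measure on $\mathcal X$, and let $\Theta$ be a metric space with its Borel $\sigma$-algebra (for instance $\Theta\subseteq\mathbb R^p$), with distance written $|u-\theta|$. Write $\mathbf X^n=(X_1,\dots,X_n)$ and $\mathcal F_n=\sigma(\mathbf X^n)$. Let $\psi_n(x|\mathbf x^{n-1})$ and $f_{\theta,n}(x|\mathbf x^{n-1})=f^{(\nu)}_{\theta,n}(x|\mathbf x^{n-1})$ ($n\ge1$ and $n>\nu$, respectively) be jointly measurable conditional probability densities with respect to $\mu$; the latter may depend on the change point $\nu$. Let $\mathsf P_\infty$ and $\mathsf P_{\nu,\theta}$ ($\nu\in\mathbb Z_+=\{0,1,\dots\}$, $\theta\in\Theta$) be probability measures on $(\Omega,\mathcal F)$ such that for every $n$ the density of $\mathbf X^n$ with respect to $\mu^{\otimes n}$ is $\prod_{i=1}^n\psi_i(X_i|\mathbf X^{i-1})$ under $\mathsf P_\infty$ and $\prod_{i=1}^{\min(\nu,n)}\psi_i(X_i|\mathbf X^{i-1})\prod_{i=\nu+1}^{n}f_{\theta,i}(X_i|\mathbf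 X^{i-1})$ under $\mathsf P_{\nu,\theta}$. Put, for $n>k\ge0$ (with values in $[0,\infty]$ and $[-\infty,\infty]$, and $f=f^{(k)}$), $$\Lambda_n^k(\theta)=\prod_{i=k+1}^n\frac{f_{\theta,i}(X_i|\mathbf X^{i-1})}{\psi_i(X_i|\mathbf X^{i-1})},\qquad Z_n^k(\theta)=\sum_{i=k+1}^n\log\frac{f_{\theta,i}(X_i|\mathbf X^{i-1})}{\psi_i(X_i|\mathbf X^{i-1})}.$$ **Procedure.** Let $W$ be a probability measure on $\Theta$ with $W\{u:|u-\theta|<\delta\}>0$ for all $\theta\in\Theta$, $\delta>0$. Let $R_n^W=\sum_{k=1}^{n}\int_\Theta\Lambda_n^{k-1}(\theta)\,dW(\theta)$ and let $T_a=\inf\{n\ge1:\log R_n^W\ge a\}$ ($\inf\varnothing=\infty$) be the weighted Shiryaev–Roberts (WSR) procedure. **Class and risk.** For $0<\beta<1$ and integers $\ell,m\ge1$ let $\mathcal H(\beta,\ell,m)$ be the set of $(\mathcal F_n)$-stopping times $\tau$ with values in $\mathbb Z_+\cup\{\infty\}$ for which $\mathsf P_\infty(\tau\ge k)>0$ and $\mathsf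 P_\infty(\tau<k+m\,|\,\tau\ge k)\le\beta$ for all $1\le k\le\ell$. Let $\mathcal R^q_{\nu,\theta}(\tau)=\mathsf E_{\nu,\theta}[(\tau-\nu)^q\,|\,\tau>\nu]\in[0,\infty]$ (read as $0$ if $\mathsf P_{\nu,\theta}(\tau>\nu)=0$). **Parameters.** Let $0<\varrho_{1,\beta}<1$ and $0<\check\delta_\beta<1$ be functions of $\beta\in(0,1)$ with $\varrho_{1,\beta}+\check\delta_\beta\to0$ and $(|\log\varrho_{1,\beta}|+|\log\check\delta_\beta|)/|\log\beta|\to0$ as $\beta\to0$, and put $\varrho_{2,\beta}=\check\delta_\beta\varrho_{1,\beta}$. Let $\ell_\beta,m_\beta\ge1$ be integers depending on $\beta\in(0,1)$, and put $k^*_\beta=\ell_\beta+m_\beta$, $\alpha_{1,\beta}=\beta+(1-\varrho_{1,\beta})^{m_\beta+1}$, $\alpha_{2,\beta}=\beta(1-\varrho_{2,\beta})^{\ell_\beta+m_\beta}/(1+\beta)$. The conditions are: * $(\mathbf H_1)$ $\lim_{\beta\to0}|\log\alpha_{1,\beta}|/|\log\beta|=1$; * $(\mathbf H_2)$ $\lim_{\beta\to0}|\log\alpha_{2,\beta}|/|\log\beta|=1$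 and $\lim_{\beta\to0}\alpha_{2,\beta}\varrho_{2,\beta}k^*_\beta=0$; * $(\mathbf A_1)$ $I_\theta>0$ and $\lim_{N\to\infty}\mathsf P_{k,\theta}\{\frac1N\max_{1\le n\le N}Z_{k+n}^k(\theta)\ge(1+\varepsilon)I_\theta\}=0$ for all $\theta\in\Theta$, $k\ge0$, $\varepsilon>0$; * $(\mathbf A_2(r))$ $\theta\mapsto I_\theta$ is positive and continuous on $\Theta$, and for all $\theta\in\Theta$, $\varepsilon>0$ the limit $\lim_{\delta\to0}\sum_{n=1}^\infty n^{r-1}\sup_{\nu\ge0}\mathsf P_{\nu,\theta}\big(\frac1n\inf_{|u-\theta|<\delta}Z_{\nu+n}^\nu(u)<I_\theta-\varepsilon\big)$ is finite (outer probability, if the event is not measurable). **Theorem.** Assume $(\mathbf H_1)$ and $(\mathbf H_2)$, and let $T_\beta=T_{a_\beta}$ with $a_\beta=\log\frac{1-\alpha_{2,\beta}}{\varrho_{2,\beta}\alpha_{2,\beta}}$. Then $T_\beta\in\mathcal H(\beta,\ell_\beta,m_\beta)$ for every $0<\beta<1$. If, in addition, $(\mathbf A_1)$ and $(\mathbf A_2(r))$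 hold for some $r\ge1$ and the same real-valued function $\theta\mapsto I_\theta$, then for every $0<q\le r$ (in particular for $q=r$) and every $\theta\in\Theta$, as $\beta\to0$, $$\inf_{\tau\in\mathcal H(\beta,\ell_\beta,m_\beta)}\mathcal R^q_{\nu,\theta}(\tau)\sim\Big(\frac{|\log\beta|}{I_\theta}\Big)^q\sim\mathcal R^q_{\nu,\theta}(T_\beta)\quad\text{for every }\nu\in\mathbb Z_+,$$ $$\inf_{\tau\in\mathcal H(\beta,\ell_\beta,m_\beta)}\max_{0\le\nu\le k^*_\beta}\mathcal R^q_{\nu,\theta}(\tau)\sim\Big(\frac{|\log\beta|}{I_\theta}\Big)^q\sim\max_{0\le\nu\le k^*_\beta}\mathcal R^q_{\nu,\theta}(T_\beta),$$ where $u_\beta\sim v_\beta$ means $u_\beta/v_\beta\to1$. Consequently the ratios of the risk of $T_\beta$ to the infimum of the risk over $\mathcal H(\beta,\ell_\beta,m_\beta)$, pointwise in $\nu$ and for the maximum over $0\le\nu\le k_\beta^*$, tend to $1$: $T_\beta$ is first-order asymptotically pointwise optimal and minimax, for all moments up to order $r$. -/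

import Mathlib

open MeasureTheory ProbabilityTheory Filter Topology
open scoped ENNReal NNReal

/-- The general non-i.i.d. change-point model. Observations are numbered from `0`: `X i` is the
`(i+1)`-th observation, so a change at `ν` (the last pre-change observation is the `ν`-th one)
means that `X i` is pre-change iff `i < ν`.

* `ψ n h x` is the conditional pre-change density of the `(n+1)`-th observation at `x`,
  given that the first `n` observations are `h`;
* `f ν θ n h x` is the conditional post-change density of the `(n+1)`-th observation, which may
  depend on the change point `ν ≤ n` and on the parameter `θ`;
* `Pinf` is the no-change measure and `P ν θ` the measure for the change point `ν`. -/
structure ChangePointModel (Ω 𝒳 Θ : Type*) [MeasurableSpace Ω] [MeasurableSpace 𝒳]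
    [MeasurableSpace Θ] where
  X : ℕ → Ω → 𝒳
  measurable_X : ∀ i, Measurable (X i)
  /-- reference measure of the densities -/
  μ : Measure 𝒳
  sigmaFinite_μ : SigmaFinite μ
  ψ : (n : ℕ) → (Fin n → 𝒳) → 𝒳 → ℝ≥0
  f : ℕ → Θ → (n : ℕ) → (Fin n → 𝒳) → 𝒳 → ℝ≥0
  measurable_ψ : ∀ n, Measurable fun p : (Fin n → 𝒳) × 𝒳 => ψ n p.1 p.2
  measurable_f : ∀ ν n, Measurable fun p : Θ × (Fin n → 𝒳) × 𝒳 => f ν p.1 n p.2.1 p.2.2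
  lintegral_ψ : ∀ n h, ∫⁻ x, (ψ n h x : ℝ≥0∞) ∂μ = 1
  lintegral_f : ∀ ν θ n h, ν ≤ n → ∫⁻ x, (f ν θ n h x : ℝ≥0∞) ∂μ = 1
  Pinf : Measure Ω
  P : ℕ → Θ → Measure Ω
  isProbabilityMeasure_Pinf : IsProbabilityMeasure Pinf
  isProbabilityMeasure_P : ∀ ν θ, IsProbabilityMeasure (P ν θ)
  /-- joint density of the first `n` observations when there is no change -/
  map_Pinf : ∀ n : ℕ, Pinf.map (fun ω (i : Fin n) => X i ω) =
    (Measure.pi fun _ : Fin n => μ).withDensity fun x =>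
      ∏ i : Fin n, (ψ i (fun j => x (Fin.castLE i.isLt.le j)) (x i) : ℝ≥0∞)
  /-- joint density of the first `n` observations when the change occurs at `ν` -/
  map_P : ∀ (ν : ℕ) (θ : Θ) (n : ℕ), (P ν θ).map (fun ω (i : Fin n) => X i ω) =
    (Measure.pi fun _ : Fin n => μ).withDensity fun x =>
      ∏ i : Fin n, (if (i : ℕ) < ν then
        (ψ i (fun j => x (Fin.castLE i.isLt.le j)) (x i) : ℝ≥0∞)
        else (f ν θ i (fun j => x (Fin.castLE i.isLt.le j)) (x i) : ℝ≥0∞))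

namespace ChangePointModel

noncomputable section

variable {Ω 𝒳 Θ : Type*} [MeasurableSpace Ω] [MeasurableSpace 𝒳] [MeasurableSpace Θ]

/-- The observation filtration: `ℱ n` is generated by the first `n` observations
(so `ℱ 0` is trivial). -/
def filtration (M : ChangePointModel Ω 𝒳 Θ) : Filtration ℕ (inferInstance : MeasurableSpace Ω) where
  seq n := ⨆ i : Fin n, MeasurableSpace.comap (M.X i) inferInstance
  mono' _ n hmn := iSup_le fun i =>
    le_iSup (fun j : Fin n => MeasurableSpace.comap (M.X j) inferInstance) (Fin.castLE hmn i)
  le' _ := iSup_le fun i => (M.measurable_X i).comap_le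

/-- The likelihood ratio of the `(i+1)`-th observation (post-change density for change point `k`
and parameter `θ` over the pre-change density), with values in `[0, ∞]`; in particular it is `∞`
where only the pre-change density vanishes. -/
def likelihoodRatio (M : ChangePointModel Ω 𝒳 Θ) (k : ℕ) (θ : Θ) (i : ℕ) (ω : Ω) : ℝ≥0∞ :=
  (M.f k θ i (fun j : Fin i => M.X j ω) (M.X i ω) : ℝ≥0∞) /
    (M.ψ i (fun j : Fin i => M.X j ω) (M.X i ω) : ℝ≥0∞)

/-- The log-likelihood ratio `Z_n^k(θ)`, the sum over observations number `k+1, …, n`. -/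
def llr (M : ChangePointModel Ω 𝒳 Θ) (k n : ℕ) (θ : Θ) (ω : Ω) : EReal :=
  ∑ i ∈ Finset.Ico k n, (M.likelihoodRatio k θ i ω).log

/-- The weighted likelihood ratio `Λ_n^k(W)`. -/
def weightedLR (M : ChangePointModel Ω 𝒳 Θ) (W : Measure Θ) (k n : ℕ) (ω : Ω) : ℝ≥0∞ :=
  ∫⁻ θ, ∏ i ∈ Finset.Ico k n, M.likelihoodRatio k θ i ω ∂W

/-- The weighted Shiryaev–Roberts statistic `R_n^W`. -/
def wsrStat (M : ChangePointModel Ω 𝒳 Θ) (W : Measure Θ) (n : ℕ) (ω : Ω) : ℝ≥0∞ :=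
  ∑ k ∈ Finset.range n, M.weightedLR W k n ω

/-- The WSR procedure `T_a = inf {n ≥ 1 : log R_n^W ≥ a}`, with `inf ∅ = ∞`. -/
def wsrTime (M : ChangePointModel Ω 𝒳 Θ) (W : Measure Θ) (a : ℝ) (ω : Ω) : ℕ∞ :=
  ⨅ (n : ℕ) (_ : 1 ≤ n ∧ (a : EReal) ≤ (M.wsrStat W n ω).log), (n : ℕ∞)

/-- The class `ℋ(β, ℓ, m)` of stopping times whose local conditional probability of false alarm
is well defined and at most `β` for every window `[k, k + m - 1]`, `1 ≤ k ≤ ℓ`. -/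
def localClass (M : ChangePointModel Ω 𝒳 Θ) (β : ℝ) (ℓ m : ℕ) : Set (Ω → ℕ∞) :=
  {τ | IsStoppingTime M.filtration τ ∧ ∀ k : ℕ, 1 ≤ k → k ≤ ℓ →
    M.Pinf {ω | (k : ℕ∞) ≤ τ ω} ≠ 0 ∧
    (cond M.Pinf {ω | (k : ℕ∞) ≤ τ ω}) {ω | τ ω < ((k + m : ℕ) : ℕ∞)} ≤ ENNReal.ofReal β}

/-- The conditional `r`-th moment of the detection delay `E_{ν,θ}[(τ - ν)^r | τ > ν]`,
with values in `[0, ∞]`. -/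
def risk (M : ChangePointModel Ω 𝒳 Θ) (r : ℝ) (ν : ℕ) (θ : Θ) (τ : Ω → ℕ∞) : ℝ≥0∞ :=
  ∫⁻ ω, ((τ ω : ℝ≥0∞) - (ν : ℝ≥0∞)) ^ r ∂(cond (M.P ν θ) {ω | (ν : ℕ∞) < τ ω})

/-- The right-tail condition (A₁). -/
def RightTail (M : ChangePointModel Ω 𝒳 Θ) (I : Θ → ℝ) : Prop :=
  ∀ θ, 0 < I θ ∧ ∀ (k : ℕ) (ε : ℝ), 0 < ε →
    Tendsto (fun N : ℕ => M.P k θ {ω |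
      (((1 + ε) * I θ : ℝ) : EReal) ≤ (⨆ n ∈ Finset.Icc 1 N, M.llr k (k + n) θ ω) / (N : EReal)})
      atTop (𝓝 0)

/-- The series in the left-tail condition, for fixed `δ`:
`∑_{n ≥ 1} n^{r-1} sup_ν P_{ν,θ}(n⁻¹ inf_{|u-θ|<δ} Z_{ν+n}^ν(u) < I_θ - ε)`. -/
def leftTailSum [PseudoMetricSpace Θ] (M : ChangePointModel Ω 𝒳 Θ) (I : Θ → ℝ) (r ε : ℝ) (θ : Θ)
    (δ : ℝ) : ℝ≥0∞ :=
  ∑' n : ℕ, ((n + 1 : ℕ) : ℝ≥0∞) ^ (r - 1) *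
    ⨆ ν : ℕ, M.P ν θ {ω |
      (⨅ u ∈ Metric.ball θ δ, M.llr ν (ν + (n + 1)) u ω) / ((n + 1 : ℕ) : EReal)
        < ((I θ - ε : ℝ) : EReal)}

/-- The left-tail condition (A₂(r)). -/
def LeftTail [PseudoMetricSpace Θ] (M : ChangePointModel Ω 𝒳 Θ) (I : Θ → ℝ) (r : ℝ) : Prop :=
  Continuous I ∧ ∀ θ, 0 < I θ ∧ ∀ ε : ℝ, 0 < ε →
    ∃ Υ : ℝ≥0∞, Υ ≠ ∞ ∧ Tendsto (M.leftTailSum I r ε θ) (𝓝[>] 0) (𝓝 Υ)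

end

end ChangePointModel

noncomputable section

/-- `α₁(β, m) = β + (1 - ϱ₁)^{m+1}`. -/
def alphaOne (β ϱ₁ : ℝ) (m : ℕ) : ℝ := β + (1 - ϱ₁) ^ (m + 1)

/-- `α₂(β, ℓ, m) = β (1 - ϱ₂)^{ℓ+m} / (1 + β)`. -/
def alphaTwo (β ϱ₂ : ℝ) (ℓ m : ℕ) : ℝ := β * (1 - ϱ₂) ^ (ℓ + m) / (1 + β)

/-- The standing requirements on the functions `ϱ_{1,β}` and `δ̌_β`. -/
def AdmissibleRates (ϱ₁ δ : ℝ → ℝ) : Prop :=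
  (∀ β, 0 < β → β < 1 → (0 < ϱ₁ β ∧ ϱ₁ β < 1) ∧ (0 < δ β ∧ δ β < 1)) ∧
  Tendsto (fun β => ϱ₁ β + δ β) (𝓝[>] 0) (𝓝 0) ∧
  Tendsto (fun β => (|Real.log (ϱ₁ β)| + |Real.log (δ β)|) / |Real.log β|) (𝓝[>] 0) (𝓝 0)

/-- Condition (H₁). -/
def CondHOne (ϱ₁ : ℝ → ℝ) (m : ℝ → ℕ) : Prop :=
  Tendsto (fun β => |Real.log (alphaOne β (ϱ₁ β) (m β))| / |Real.log β|) (𝓝[>] 0) (𝓝 1)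

/-- Condition (H₂), with `k*_β = ℓ_β + m_β`. -/
def CondHTwo (ϱ₂ : ℝ → ℝ) (ℓ m : ℝ → ℕ) : Prop :=
  Tendsto (fun β => |Real.log (alphaTwo β (ϱ₂ β) (ℓ β) (m β))| / |Real.log β|) (𝓝[>] 0) (𝓝 1) ∧
  Tendsto (fun β => alphaTwo β (ϱ₂ β) (ℓ β) (m β) * ϱ₂ β * ((ℓ β + m β : ℕ) : ℝ)) (𝓝[>] 0) (𝓝 0)

/-- The threshold `log ((1 - α₂) / (ϱ₂ α₂))`. -/
def wsrThreshold (α₂ ϱ₂ : ℝ) : ℝ := Real.log ((1 - α₂) / (ϱ₂ * α₂))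

/-- `u_β ~ v_β` as `β → 0+`: the ratio tends to `1`. -/
def AsympEquiv (u v : ℝ → ℝ≥0∞) : Prop :=
  Tendsto (fun β => u β / v β) (𝓝[>] 0) (𝓝 1)

end

/-! Everything rests on change of measure at fixed times. Where it is finite, `Λ_n^k(θ)` is the
density of `P k θ` with respect to `Pinf` on `ℱ n`; in general it is only a subdensity. Both
asymptotic relations follow by squeezing every risk between `c * (|log β| / I θ) ^ q` for `c < 1`
and for `c > 1`.

False alarms (`exp_mul_Pinf_wsrTime_le`): on `{T = n}` the statistic is at least `exp a`, and it is
a sum of `n` mixed likelihood ratios. Integrating each one under `Pinf` over the disjoint events `{T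
= n}`, `n ≤ N`, gives at most `1`, so `Pinf (T ≤ N) ≤ N / exp a`. The threshold makes this at most
`β / (1 + β)` for `N = ℓ + m`, which implies membership in the local class.

Lower bound (`eventually_mul_le_risk`): a procedure in the class stops in its first window with
`Pinf`-probability at most `β`. Changing measure costs a factor `exp ((1 + ε) I N)`, up to an event
that is negligible by (A₁). With `N` about `(1 - ε)|log β| / I` the product is at most `exp (-ε²
|log β|)`, so the delay exceeds `N` with probability near one. (H₁) makes the window longer than `ν
+ N`.

Upper bound (`eventually_risk_wsrTime_le`): the statistic dominates its term for the true change
point, restricted to a small ball around `θ`. Hence late stopping forces the infimum of the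
log-likelihood ratios over that ball to be small. Summing tails bounds the moment by `N ^ q` plus a
constant multiple of the series in (A₂(r)), with `N` about `a / I` and `a` at most about `|log β|`.
Conditioning on `T > ν` is harmless by (H₂), uniformly in `ν ≤ ℓ + m`. -/

namespace ChangePointModel

variable {Ω 𝒳 Θ : Type*} [MeasurableSpace Ω] [MeasurableSpace 𝒳] [MeasurableSpace Θ]

/-- The vector of the first `n` observations. -/
def obs (M : ChangePointModel Ω 𝒳 Θ) (n : ℕ) (ω : Ω) : Fin n → 𝒳 := fun i => M.X i ω

lemma measurable_obs (M : ChangePointModel Ω 𝒳 Θ) (n : ℕ) : Measurable (M.obs n) :=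
  measurable_pi_lambda _ fun i => M.measurable_X i

lemma filtration_eq_comap (M : ChangePointModel Ω 𝒳 Θ) (n : ℕ) :
    M.filtration n = MeasurableSpace.comap (M.obs n) inferInstance := by
  change (⨆ i : Fin n, MeasurableSpace.comap (M.X i) inferInstance) =
    MeasurableSpace.comap (M.obs n) (⨆ i, MeasurableSpace.comap (fun x => x i) inferInstance)
  rw [MeasurableSpace.comap_iSup]
  simp only [MeasurableSpace.comap_comp]
  rfl

/-! ### Likelihood ratios on the space of observation vectors. -/

section Densities

variable (M : ChangePointModel Ω 𝒳 Θ)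

/-- Pre-change conditional density of the `i`-th coordinate of a vector of observations. -/
noncomputable def preFactor {n : ℕ} (x : Fin n → 𝒳) (i : Fin n) : ℝ≥0∞ :=
  (M.ψ i (fun j => x (Fin.castLE i.isLt.le j)) (x i) : ℝ≥0∞)

/-- Post-change conditional density of the `i`-th coordinate of a vector of observations. -/
noncomputable def postFactor (ν : ℕ) (θ : Θ) {n : ℕ} (x : Fin n → 𝒳) (i : Fin n) : ℝ≥0∞ :=
  (M.f ν θ i (fun j => x (Fin.castLE i.isLt.le j)) (x i) : ℝ≥0∞)

/-- The likelihood ratio as a function of the vector of observations. -/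
noncomputable def vecLR (k : ℕ) (n : ℕ) (θ : Θ) (x : Fin n → 𝒳) : ℝ≥0∞ :=
  ∏ i : Fin n, if (i : ℕ) < k then 1 else M.postFactor k θ x i / M.preFactor x i

lemma measurable_preFactor {n : ℕ} (i : Fin n) :
    Measurable fun x : Fin n → 𝒳 => M.preFactor x i := by
  have h : Measurable fun x : Fin n → 𝒳 =>
      ((fun j : Fin i => x (Fin.castLE i.isLt.le j)), x i) := by fun_prop
  exact ((M.measurable_ψ i).comp h).coe_nnreal_ennreal

lemma measurable_postFactor (ν : ℕ) {n : ℕ} (i : Fin n) :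
    Measurable fun p : Θ × (Fin n → 𝒳) => M.postFactor ν p.1 p.2 i := by
  have h : Measurable fun p : Θ × (Fin n → 𝒳) =>
      (p.1, (fun j : Fin i => p.2 (Fin.castLE i.isLt.le j)), p.2 i) := by fun_prop
  exact ((M.measurable_f ν i).comp h).coe_nnreal_ennreal

/-- Joint measurability in parameter and data is what Tonelli needs for averaging over the prior. -/
lemma measurable_vecLR (k n : ℕ) :
    Measurable fun p : Θ × (Fin n → 𝒳) => M.vecLR k n p.1 p.2 := by
  refine Finset.measurable_prod _ fun i _ => ?_
  split_ifs
  · exact measurable_const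
  · exact (M.measurable_postFactor k i).div ((M.measurable_preFactor i).comp measurable_snd)

lemma prod_likelihoodRatio_eq (k n : ℕ) (θ : Θ) (ω : Ω) :
    ∏ i ∈ Finset.Ico k n, M.likelihoodRatio k θ i ω = M.vecLR k n θ (M.obs n ω) := by
  have h1 : M.vecLR k n θ (M.obs n ω) =
      ∏ i : Fin n, (fun i : ℕ => if i < k then 1 else M.likelihoodRatio k θ i ω) i := rfl
  rw [h1, Fin.prod_univ_eq_prod_range
    (fun i : ℕ => if i < k then 1 else M.likelihoodRatio k θ i ω) n]
  rw [Finset.prod_ite, Finset.prod_const_one, one_mul]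
  refine Finset.prod_congr ?_ fun _ _ => rfl
  ext i
  simp [and_comm]

lemma map_obs_Pinf (n : ℕ) : M.Pinf.map (M.obs n) =
    (Measure.pi fun _ : Fin n => M.μ).withDensity fun x => ∏ i, M.preFactor x i :=
  M.map_Pinf n

lemma map_obs_P (ν : ℕ) (θ : Θ) (n : ℕ) : (M.P ν θ).map (M.obs n) =
    (Measure.pi fun _ : Fin n => M.μ).withDensity fun x =>
      ∏ i : Fin n, if (i : ℕ) < ν then M.preFactor x i else M.postFactor ν θ x i :=
  M.map_P ν θ n

/-- Multiplying the pre-change density by the likelihood ratio gives at most the density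
under the change point `k`. -/
lemma vecLR_mul_le (k n : ℕ) (θ : Θ) (x : Fin n → 𝒳) :
    (∏ i, M.preFactor x i) * M.vecLR k n θ x ≤
      ∏ i : Fin n, if (i : ℕ) < k then M.preFactor x i else M.postFactor k θ x i := by
  rw [vecLR, ← Finset.prod_mul_distrib]
  refine Finset.prod_le_prod' fun i _ => ?_
  split_ifs
  · simp
  · exact ENNReal.mul_div_le

/-- Where the likelihood ratio is finite, the density under the change point `k` is the
pre-change density times the likelihood ratio. -/
lemma le_vecLR_mul (k n : ℕ) (θ : Θ) (x : Fin n → 𝒳) (hx : M.vecLR k n θ x ≠ ∞) :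
    (∏ i : Fin n, if (i : ℕ) < k then M.preFactor x i else M.postFactor k θ x i) ≤
      (∏ i, M.preFactor x i) * M.vecLR k n θ x := by
  -- Since `0 * ∞ = 0`, a finite product may hide an infinite factor, but only if some post-change
  -- factor vanishes; then the left side is `0`. Otherwise a zero pre-change factor from index `k`
  -- on would make the product infinite.
  by_cases h0 : ∃ i : Fin n, ¬ (i : ℕ) < k ∧ M.postFactor k θ x i = 0
  · obtain ⟨i, hi, hi0⟩ := h0
    rw [Finset.prod_eq_zero (Finset.mem_univ i) (by simp [hi, hi0])]
    exact zero_le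
  push Not at h0
  have hψ : ∀ i : Fin n, k ≤ i → M.preFactor x i ≠ 0 := by
    intro i hi hi0
    apply hx
    rw [vecLR, ← Finset.mul_prod_erase _ _ (Finset.mem_univ i), if_neg (by omega), hi0,
      ENNReal.div_zero (h0 i hi)]
    refine ENNReal.top_mul (Finset.prod_ne_zero_iff.2 fun j _ => ?_)
    split_ifs with h
    · exact one_ne_zero
    · exact ENNReal.div_ne_zero.2 ⟨h0 j (by omega), ENNReal.coe_ne_top⟩
  rw [vecLR, ← Finset.prod_mul_distrib]
  refine Finset.prod_le_prod' fun i _ => ?_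
  split_ifs with h
  · simp
  · rw [ENNReal.mul_div_cancel (hψ i (by omega)) ENNReal.coe_ne_top]

end Densities

/-! ### Change of measure between no change and a change at `k`. -/

section ChangeOfMeasure

variable (M : ChangePointModel Ω 𝒳 Θ)

/-- The likelihood ratio is, under the no-change measure, a subdensity of `P k θ`. -/
lemma setLIntegral_prod_likelihoodRatio_le (k n : ℕ) (θ : Θ) {B : Set Ω}
    (hB : MeasurableSet[M.filtration n] B) :
    ∫⁻ ω in B, ∏ i ∈ Finset.Ico k n, M.likelihoodRatio k θ i ω ∂M.Pinf ≤ M.P k θ B := by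
  rw [filtration_eq_comap] at hB
  obtain ⟨S, hS, rfl⟩ := hB
  have hL : Measurable fun x => M.vecLR k n θ x :=
    (M.measurable_vecLR k n).comp measurable_prodMk_left
  simp_rw [prod_likelihoodRatio_eq]
  rw [← setLIntegral_map hS hL (M.measurable_obs n), ← Measure.map_apply (M.measurable_obs n) hS,
    map_obs_Pinf, map_obs_P, withDensity_apply _ hS,
    setLIntegral_withDensity_eq_setLIntegral_mul _
      (Finset.measurable_prod _ fun i _ => M.measurable_preFactor i) hL hS]
  exact lintegral_mono fun x => M.vecLR_mul_le k n θ x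

/-- Change of measure on the event that the likelihood ratio is at most `c`. -/
lemma P_inter_le (k n : ℕ) (θ : Θ) {B : Set Ω} (hB : MeasurableSet[M.filtration n] B)
    {c : ℝ≥0∞} (hc : c ≠ ∞) :
    M.P k θ (B ∩ {ω | ∏ i ∈ Finset.Ico k n, M.likelihoodRatio k θ i ω ≤ c}) ≤ c * M.Pinf B := by
  rw [filtration_eq_comap] at hB
  obtain ⟨S, hS, rfl⟩ := hB
  have hL : Measurable fun x => M.vecLR k n θ x :=
    (M.measurable_vecLR k n).comp measurable_prodMk_left
  simp_rw [prod_likelihoodRatio_eq]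
  have hS' : MeasurableSet (S ∩ {x | M.vecLR k n θ x ≤ c}) :=
    hS.inter (measurableSet_le hL measurable_const)
  change M.P k θ (M.obs n ⁻¹' (S ∩ {x | M.vecLR k n θ x ≤ c})) ≤ _
  have hd : Measurable fun x : Fin n → 𝒳 => ∏ i, M.preFactor x i :=
    Finset.measurable_prod _ fun i _ => M.measurable_preFactor i
  rw [← Measure.map_apply (M.measurable_obs n) hS', ← Measure.map_apply (M.measurable_obs n) hS,
    map_obs_Pinf, map_obs_P, withDensity_apply _ hS', withDensity_apply _ hS,
    ← lintegral_const_mul _ hd]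
  calc _ ≤ ∫⁻ x in S ∩ {x | M.vecLR k n θ x ≤ c}, c * ∏ i, M.preFactor x i
          ∂(Measure.pi fun _ : Fin n => M.μ) := by
        refine setLIntegral_mono (hd.const_mul c) fun x hx => ?_
        refine (M.le_vecLR_mul k n θ x (ne_top_of_le_ne_top hc hx.2)).trans ?_
        rw [mul_comm]
        exact mul_le_mul_left hx.2 _
    _ ≤ _ := lintegral_mono_set Set.inter_subset_left

/-- Before the change point the measures agree. -/
lemma P_eq_Pinf (ν : ℕ) (θ : Θ) {B : Set Ω} (hB : MeasurableSet[M.filtration ν] B) :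
    M.P ν θ B = M.Pinf B := by
  rw [filtration_eq_comap] at hB
  obtain ⟨S, hS, rfl⟩ := hB
  rw [← Measure.map_apply (M.measurable_obs ν) hS, ← Measure.map_apply (M.measurable_obs ν) hS,
    map_obs_Pinf, map_obs_P]
  simp

end ChangeOfMeasure

/-! ### The WSR procedure as a stopping time. -/

section Procedure

variable (M : ChangePointModel Ω 𝒳 Θ) (W : Measure Θ)

lemma measurable_weightedLR [SFinite W] (k n : ℕ) :
    Measurable[M.filtration n] (M.weightedLR W k n) := by
  have h : M.weightedLR W k n =
      (fun x => ∫⁻ θ, M.vecLR k n θ x ∂W) ∘ M.obs n := by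
    ext ω
    simp only [weightedLR, prod_likelihoodRatio_eq, Function.comp]
  rw [h, filtration_eq_comap]
  exact (M.measurable_vecLR k n).lintegral_prod_left'.comp (comap_measurable _)

lemma measurable_wsrStat [SFinite W] (n : ℕ) : Measurable[M.filtration n] (M.wsrStat W n) := by
  unfold wsrStat
  exact Finset.measurable_fun_sum _ fun k _ => M.measurable_weightedLR W k n

/-- The event that the WSR statistic reaches the threshold `exp a` at time `n`. -/
def crossing (a : ℝ) (n : ℕ) : Set Ω :=
  {ω | 1 ≤ n ∧ ENNReal.ofReal (Real.exp a) ≤ M.wsrStat W n ω}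

lemma measurableSet_crossing [SFinite W] (a : ℝ) (n : ℕ) :
    MeasurableSet[M.filtration n] (M.crossing W a n) :=
  (MeasurableSet.const _).inter (M.measurable_wsrStat W n measurableSet_Ici)

lemma coe_le_log_iff (a : ℝ) (x : ℝ≥0∞) :
    (a : EReal) ≤ x.log ↔ ENNReal.ofReal (Real.exp a) ≤ x := by
  rw [← ENNReal.log_le_log_iff, ENNReal.log_ofReal_of_pos (Real.exp_pos a), Real.log_exp]

lemma wsrTime_le_iff (a : ℝ) (n : ℕ) (ω : Ω) :
    M.wsrTime W a ω ≤ n ↔ ∃ j ≤ n, ω ∈ M.crossing W a j := by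
  constructor
  · intro h
    by_contra! hj
    have : ((n + 1 : ℕ) : ℕ∞) ≤ M.wsrTime W a ω := by
      refine le_iInf₂ fun i hi => ?_
      by_contra hlt
      exact hj i (by
        have := not_le.1 hlt
        have := Nat.cast_lt.1 this
        omega) ⟨hi.1, (coe_le_log_iff _ _).1 hi.2⟩
    have := this.trans h
    have := Nat.cast_le.1 this
    omega
  · rintro ⟨j, hj, hω⟩
    exact (iInf₂_le j ⟨hω.1, (coe_le_log_iff _ _).2 hω.2⟩).trans (Nat.cast_le.2 hj)

lemma isStoppingTime_wsrTime [SFinite W] (a : ℝ) :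
    IsStoppingTime M.filtration (M.wsrTime W a) := by
  intro n
  have h : {ω | M.wsrTime W a ω ≤ (n : ℕ)} = ⋃ j ∈ Set.Iic n, M.crossing W a j := by
    ext ω
    simp only [Set.mem_ofPred_eq, Set.mem_iUnion, Set.mem_Iic, exists_prop]
    exact M.wsrTime_le_iff W a n ω
  change MeasurableSet[M.filtration n] {ω | M.wsrTime W a ω ≤ (n : ℕ)}
  rw [h]
  exact MeasurableSet.biUnion (Set.to_countable _) fun j hj =>
    M.filtration.mono hj _ (M.measurableSet_crossing W a j)

end Procedure

end ChangePointModel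

/-! ### False alarm control and membership in the local class. -/

namespace ChangePointModel

variable {Ω 𝒳 Θ : Type*} [MeasurableSpace Ω] [MeasurableSpace 𝒳] [MeasurableSpace Θ]

lemma mem_crossing_of_wsrTime_eq (M : ChangePointModel Ω 𝒳 Θ) (W : Measure Θ) {a : ℝ} {n : ℕ}
    {ω : Ω} (h : M.wsrTime W a ω = n) : ω ∈ M.crossing W a n := by
  obtain ⟨j, hj, hω⟩ := (M.wsrTime_le_iff W a n ω).1 h.le
  have h2 := (M.wsrTime_le_iff W a j ω).2 ⟨j, le_rfl, hω⟩
  rw [h, Nat.cast_le] at h2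
  rwa [le_antisymm h2 hj]

/-- The no-change probability that the WSR procedure stops by time `N` is at most `N / exp a`. -/
lemma exp_mul_Pinf_wsrTime_le (M : ChangePointModel Ω 𝒳 Θ) (W : Measure Θ)
    [IsProbabilityMeasure W] (a : ℝ) (N : ℕ) :
    ENNReal.ofReal (Real.exp a) * M.Pinf {ω | M.wsrTime W a ω ≤ N} ≤ N := by
  have := M.isProbabilityMeasure_Pinf
  have := M.isProbabilityMeasure_P
  set T := M.wsrTime W a with hT
  set A := ENNReal.ofReal (Real.exp a)
  have hst := M.isStoppingTime_wsrTime W a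
  have hE : ∀ n : ℕ, MeasurableSet[M.filtration n] {ω | T ω = n} := fun n =>
    hst.measurableSet_eq n
  have hE' : ∀ n : ℕ, MeasurableSet {ω | T ω = n} := fun n => M.filtration.le n _ (hE n)
  have hjoint : ∀ k n : ℕ, Measurable fun p : Θ × Ω =>
      ∏ i ∈ Finset.Ico k n, M.likelihoodRatio k p.1 i p.2 := by
    intro k n
    simp_rw [prod_likelihoodRatio_eq]
    have : Measurable fun p : Θ × Ω => (p.1, M.obs n p.2) :=
      measurable_fst.prodMk ((M.measurable_obs n).comp measurable_snd)
    exact (M.measurable_vecLR k n).comp this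
  let g : ℕ → ℕ → Θ → ℝ≥0∞ := fun k n θ =>
    ∫⁻ ω in {ω | T ω = n}, ∏ i ∈ Finset.Ico k n, M.likelihoodRatio k θ i ω ∂M.Pinf
  have hg : ∀ k n, Measurable (g k n) := fun k n => (hjoint k n).lintegral_prod_right'
  have hunion : {ω | T ω ≤ N} ⊆ ⋃ n ∈ Finset.range (N + 1), {ω | T ω = n} := by
    intro ω hω
    obtain ⟨n, hn⟩ := ENat.ne_top_iff_exists.1 (ne_top_of_le_ne_top (ENat.natCast_ne_top N) hω)
    simp only [Set.mem_iUnion, Finset.mem_range, exists_prop]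
    refine ⟨n, ?_, hn.symm⟩
    have h1 : T ω ≤ N := hω
    rw [← hn, Nat.cast_le] at h1
    omega
  -- Markov's inequality on `{T = n}`, followed by Tonelli to bring the prior outside.
  have hstep : ∀ n : ℕ, A * M.Pinf {ω | T ω = n} ≤ ∑ k ∈ Finset.range n, ∫⁻ θ, g k n θ ∂W := by
    intro n
    calc A * M.Pinf {ω | T ω = n} = ∫⁻ _ in {ω | T ω = n}, A ∂M.Pinf := by
          rw [setLIntegral_const]
      _ ≤ ∫⁻ ω in {ω | T ω = n}, M.wsrStat W n ω ∂M.Pinf :=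
          setLIntegral_mono' (hE' n) fun ω hω => (M.mem_crossing_of_wsrTime_eq W hω).2
      _ = ∑ k ∈ Finset.range n, ∫⁻ ω in {ω | T ω = n}, M.weightedLR W k n ω ∂M.Pinf :=
          lintegral_finsetSum _ fun k _ =>
            (M.measurable_weightedLR W k n).mono (M.filtration.le n) le_rfl
      _ = ∑ k ∈ Finset.range n, ∫⁻ θ, g k n θ ∂W := by
          refine Finset.sum_congr rfl fun k _ => ?_
          exact lintegral_lintegral_swap ((hjoint k n).comp measurable_swap).aemeasurable
  -- The change of measure turns the `n`-th term into at most `P k θ (T = n)`, and these events are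
  -- disjoint.
  have hsum : ∀ k θ, ∑ n ∈ Finset.range (N + 1), g k n θ ≤ 1 := by
    intro k θ
    calc _ ≤ ∑ n ∈ Finset.range (N + 1), M.P k θ {ω | T ω = n} :=
          Finset.sum_le_sum fun n _ => M.setLIntegral_prod_likelihoodRatio_le k n θ (hE n)
      _ = M.P k θ (⋃ n ∈ Finset.range (N + 1), {ω | T ω = n}) := by
          refine (measure_biUnion_finset ?_ fun n _ => hE' n).symm
          intro i _ j _ hij
          refine Set.disjoint_left.2 fun ω hi hj => hij ?_
          exact Nat.cast_injective (R := ℕ∞) (hi.symm.trans hj)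
      _ ≤ 1 := prob_le_one
  calc A * M.Pinf {ω | T ω ≤ N}
      ≤ A * ∑ n ∈ Finset.range (N + 1), M.Pinf {ω | T ω = n} := by
        gcongr
        exact (measure_mono hunion).trans (measure_biUnion_finset_le _ _)
    _ ≤ ∑ n ∈ Finset.range (N + 1), ∑ k ∈ Finset.range N, ∫⁻ θ, g k n θ ∂W := by
        rw [Finset.mul_sum]
        refine Finset.sum_le_sum fun n hn => (hstep n).trans ?_
        exact Finset.sum_le_sum_of_subset
          (Finset.range_mono (Nat.lt_succ_iff.1 (Finset.mem_range.1 hn)))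
    _ = ∑ k ∈ Finset.range N, ∫⁻ θ, ∑ n ∈ Finset.range (N + 1), g k n θ ∂W := by
        rw [Finset.sum_comm]
        exact Finset.sum_congr rfl fun k _ => (lintegral_finsetSum _ fun n _ => hg k n).symm
    _ ≤ ∑ k ∈ Finset.range N, ∫⁻ _, 1 ∂W :=
        Finset.sum_le_sum fun k _ => lintegral_mono fun θ => hsum k θ
    _ = N := by simp

lemma Pinf_wsrTime_le (M : ChangePointModel Ω 𝒳 Θ) (W : Measure Θ)
    [IsProbabilityMeasure W] (a : ℝ) (N : ℕ) :
    M.Pinf {ω | M.wsrTime W a ω ≤ N} ≤ ENNReal.ofReal (N / Real.exp a) := by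
  rw [ENNReal.ofReal_div_of_pos (Real.exp_pos a), ENNReal.ofReal_natCast,
    ENNReal.le_div_iff_mul_le (by simp [Real.exp_pos]) (by simp), mul_comm]
  exact M.exp_mul_Pinf_wsrTime_le W a N

/-- Membership in the local class follows from a bound on the unconditional false alarm
probability. -/
lemma mem_localClass_of_Pinf_le (M : ChangePointModel Ω 𝒳 Θ) {τ : Ω → ℕ∞}
    (hτ : IsStoppingTime M.filtration τ) {β : ℝ} (hβ : 0 < β) {ℓ m : ℕ}
    (h : M.Pinf {ω | τ ω < ((ℓ + m : ℕ) : ℕ∞)} ≤ ENNReal.ofReal (β / (1 + β))) :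
    τ ∈ M.localClass β ℓ m := by
  have := M.isProbabilityMeasure_Pinf
  refine ⟨hτ, fun k _ hk => ?_⟩
  have hlt : M.Pinf {ω | τ ω < ((k + m : ℕ) : ℕ∞)} ≤ ENNReal.ofReal (β / (1 + β)) := by
    refine (measure_mono fun ω (hω : τ ω < ((k + m : ℕ) : ℕ∞)) => ?_).trans h
    exact hω.trans_le (Nat.cast_le.2 (by omega))
  have hmeas : MeasurableSet {ω | (k : ℕ∞) ≤ τ ω} :=
    M.filtration.le k _ (hτ.measurableSet_ge k)
  -- The level `β / (1 + β)` is chosen so that its quotient by its complement `1 / (1 + β)` is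
  -- exactly `β`.
  have hge : ENNReal.ofReal (1 / (1 + β)) ≤ M.Pinf {ω | (k : ℕ∞) ≤ τ ω} := by
    have h1 : M.Pinf {ω | (k : ℕ∞) ≤ τ ω}ᶜ ≤ ENNReal.ofReal (β / (1 + β)) := by
      refine (measure_mono fun ω (hω : ¬ (k : ℕ∞) ≤ τ ω) => ?_).trans hlt
      exact (not_le.1 hω).trans_le (Nat.cast_le.2 (by omega))
    rw [prob_compl_eq_one_sub hmeas, tsub_le_iff_right] at h1
    have h2 : (1 : ℝ≥0∞) = ENNReal.ofReal (β / (1 + β)) + ENNReal.ofReal (1 / (1 + β)) := by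
      rw [← ENNReal.ofReal_add (by positivity) (by positivity), ← ENNReal.ofReal_one]
      congr 1
      field_simp
      ring
    rw [h2] at h1
    exact (ENNReal.add_le_add_iff_left ENNReal.ofReal_ne_top).1 h1
  have hne : M.Pinf {ω | (k : ℕ∞) ≤ τ ω} ≠ 0 :=
    (lt_of_lt_of_le (ENNReal.ofReal_pos.2 (by positivity)) hge).ne'
  refine ⟨hne, ?_⟩
  rw [cond_apply hmeas, mul_comm, ← div_eq_mul_inv,
    ENNReal.div_le_iff_le_mul (Or.inl hne) (Or.inl (measure_ne_top _ _))]
  calc _ ≤ ENNReal.ofReal (β / (1 + β)) := (measure_mono Set.inter_subset_right).trans hlt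
    _ = ENNReal.ofReal β * ENNReal.ofReal (1 / (1 + β)) := by
        rw [← ENNReal.ofReal_mul hβ.le]; congr 1; ring
    _ ≤ _ := by gcongr

end ChangePointModel

/-- Multiply Bernoulli's inequality `1 + N ϱ ≤ (1 + ϱ) ^ N` by `(1 - ϱ) ^ N` and use `(1 + ϱ)(1 - ϱ)
≤ 1`. -/
lemma mul_one_sub_pow_le {ϱ : ℝ} (h0 : 0 < ϱ) (h1 : ϱ < 1) (N : ℕ) :
    N * ϱ * (1 - ϱ) ^ N ≤ 1 - (1 - ϱ) ^ N := by
  have hb := one_add_mul_le_pow (a := ϱ) (by linarith) N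
  have h2 : (1 + ϱ) ^ N * (1 - ϱ) ^ N ≤ 1 := by
    rw [← mul_pow]
    exact pow_le_one₀ (by nlinarith) (by nlinarith)
  have h3 : 0 < (1 - ϱ) ^ N := pow_pos (by linarith) N
  nlinarith

lemma alphaTwo_pos {β ϱ : ℝ} (hβ : 0 < β) (h1 : ϱ < 1) (ℓ m : ℕ) :
    0 < alphaTwo β ϱ ℓ m := by
  have : 0 < 1 - ϱ := by linarith
  unfold alphaTwo
  positivity

lemma alphaTwo_le_pow {β ϱ : ℝ} (hβ : 0 < β) (h1 : ϱ < 1) (ℓ m : ℕ) :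
    alphaTwo β ϱ ℓ m ≤ (1 - ϱ) ^ (ℓ + m) := by
  have h : 0 < (1 - ϱ) ^ (ℓ + m) := pow_pos (by linarith) _
  unfold alphaTwo
  rw [div_le_iff₀ (by linarith)]
  nlinarith

lemma alphaTwo_lt {β ϱ : ℝ} (hβ : 0 < β) (h0 : 0 < ϱ) (h1 : ϱ < 1) (ℓ m : ℕ) :
    alphaTwo β ϱ ℓ m < β := by
  have h : (1 - ϱ) ^ (ℓ + m) ≤ 1 := pow_le_one₀ (by linarith) (by linarith)
  unfold alphaTwo
  rw [div_lt_iff₀ (by linarith)]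
  nlinarith

lemma exp_wsrThreshold {α ϱ : ℝ} (h0 : 0 < α) (h1 : α < 1) (hϱ : 0 < ϱ) :
    Real.exp (wsrThreshold α ϱ) = (1 - α) / (ϱ * α) :=
  Real.exp_log (div_pos (by linarith) (by positivity))

namespace ChangePointModel

variable {Ω 𝒳 Θ : Type*} [MeasurableSpace Ω] [MeasurableSpace 𝒳] [MeasurableSpace Θ]

/-- With `p = (1 - ϱ) ^ (ℓ + m)` the bound `(ℓ + m) / exp a` equals `β / (1 + β) * ((ℓ + m) ϱ p) /
(1 - α₂)`, and `(ℓ + m) ϱ p ≤ 1 - p ≤ 1 - α₂`. -/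
lemma wsrTime_mem_localClass (M : ChangePointModel Ω 𝒳 Θ) (W : Measure Θ)
    [IsProbabilityMeasure W] {β ϱ : ℝ} (hβ : 0 < β) (hβ1 : β < 1) (h0 : 0 < ϱ) (h1 : ϱ < 1)
    (ℓ m : ℕ) :
    M.wsrTime W (wsrThreshold (alphaTwo β ϱ ℓ m) ϱ) ∈ M.localClass β ℓ m := by
  refine M.mem_localClass_of_Pinf_le (M.isStoppingTime_wsrTime W _) hβ ?_
  have hα := alphaTwo_pos hβ h1 ℓ m
  have hα1 : alphaTwo β ϱ ℓ m < 1 := (alphaTwo_lt hβ h0 h1 ℓ m).trans hβ1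
  have hT := M.Pinf_wsrTime_le W (wsrThreshold (alphaTwo β ϱ ℓ m) ϱ) (ℓ + m)
  refine le_trans (measure_mono ?_) (hT.trans ?_)
  · intro ω (hω : M.wsrTime W _ ω < _)
    exact hω.le
  refine ENNReal.ofReal_le_ofReal ?_
  rw [exp_wsrThreshold hα hα1 h0, div_div_eq_mul_div, div_le_iff₀ (by linarith)]
  have h2 := mul_one_sub_pow_le h0 h1 (ℓ + m)
  have h3 := alphaTwo_le_pow hβ h1 ℓ m
  have h4 : ((ℓ + m : ℕ) : ℝ) * (ϱ * alphaTwo β ϱ ℓ m) =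
      β / (1 + β) * ((ℓ + m : ℕ) * ϱ * (1 - ϱ) ^ (ℓ + m)) := by
    unfold alphaTwo; ring
  rw [h4]
  exact mul_le_mul_of_nonneg_left (by linarith) (by positivity)

end ChangePointModel

/-! ### Window length as `β → 0` and the lower bound for the risk. -/

lemma tendsto_abs_log_atTop : Tendsto (fun β : ℝ => |Real.log β|) (𝓝[>] 0) atTop :=
  tendsto_abs_atBot_atTop.comp Real.tendsto_log_nhdsGT_zero

lemma eventually_mem_unit_interval : ∀ᶠ β : ℝ in 𝓝[>] 0, 0 < β ∧ β < 1 :=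
  Ioo_mem_nhdsGT one_pos

lemma abs_log_of_lt_one {β : ℝ} (h0 : 0 < β) (h1 : β < 1) : |Real.log β| = -Real.log β :=
  abs_of_neg (Real.log_neg h0 h1)

/-- Under (H₁) the window length grows faster than any multiple of `|log β|`. -/
lemma CondHOne.eventually_mul_abs_log_le {ϱ₁ δ : ℝ → ℝ} {m : ℝ → ℕ}
    (hrates : AdmissibleRates ϱ₁ δ) (H1 : CondHOne ϱ₁ m) {C : ℝ} (hC : 0 < C) :
    ∀ᶠ β in 𝓝[>] 0, C * |Real.log β| ≤ m β := by
  have hs : 0 < 1 / (4 * (C + 1)) := by positivity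
  filter_upwards [eventually_mem_unit_interval, tendsto_abs_log_atTop.eventually_ge_atTop 2,
    H1.eventually (lt_mem_nhds (show (1 / 2 : ℝ) < 1 by norm_num)),
    hrates.2.1.eventually (gt_mem_nhds hs)] with β hβ hL hα hsum
  obtain ⟨⟨hϱ0, hϱ1⟩, hδ0, -⟩ := hrates.1 β hβ.1 hβ.2
  have hLpos : 0 < |Real.log β| := by linarith
  rw [lt_div_iff₀ hLpos] at hα
  have hpow : 0 < (1 - ϱ₁ β) ^ (m β + 1) := pow_pos (by linarith) _
  have hpow1 : (1 - ϱ₁ β) ^ (m β + 1) ≤ 1 := pow_le_one₀ (by linarith) (by linarith)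
  have hαpos : 0 < alphaOne β (ϱ₁ β) (m β) := add_pos hβ.1 hpow
  have hα2 : Real.log (alphaOne β (ϱ₁ β) (m β)) < 1 := by
    have h2 : alphaOne β (ϱ₁ β) (m β) < 2 := by unfold alphaOne; linarith [hβ.2]
    have h3 := Real.log_le_sub_one_of_pos hαpos
    linarith
  -- The logarithm is below `1` while its absolute value exceeds `|log β| / 2 ≥ 1`, so it must be
  -- negative.
  have hneg : Real.log (alphaOne β (ϱ₁ β) (m β)) < -(|Real.log β| / 2) := by
    rcases abs_cases (Real.log (alphaOne β (ϱ₁ β) (m β))) with h | h <;> linarith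
  have hmono : ((m β + 1 : ℕ) : ℝ) * Real.log (1 - ϱ₁ β) ≤
      Real.log (alphaOne β (ϱ₁ β) (m β)) := by
    rw [← Real.log_pow]
    exact Real.log_le_log hpow (by unfold alphaOne; linarith [hβ.1])
  have hs2 : 1 / (4 * (C + 1)) ≤ 1 / 4 := by
    apply one_div_le_one_div_of_le <;> linarith
  have hϱs : ϱ₁ β < 1 / (4 * (C + 1)) := by linarith
  have hlog : -(2 * ϱ₁ β) ≤ Real.log (1 - ϱ₁ β) := by
    refine le_trans ?_ (Real.one_sub_inv_le_log_of_pos (by linarith))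
    have : (1 - ϱ₁ β)⁻¹ ≤ 1 + 2 * ϱ₁ β := by
      rw [inv_le_iff_one_le_mul₀ (by linarith)]
      nlinarith
    linarith
  rw [lt_div_iff₀ (by positivity)] at hϱs
  have hm1 : (0 : ℝ) < ((m β + 1 : ℕ) : ℝ) := by positivity
  have h5 : |Real.log β| / 2 < (m β + 1 : ℕ) * (2 * ϱ₁ β) := by nlinarith
  -- Aiming at `C + 1` leaves room to pass from `m + 1` to `m`; the bound on `ϱ₁` was chosen to make
  -- `4 ϱ₁ (C + 1) < 1`.
  have h6 : (C + 1) * |Real.log β| ≤ (m β + 1 : ℕ) := by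
    have : ((m β + 1 : ℕ) : ℝ) * (4 * ϱ₁ β) * (C + 1) ≤ (m β + 1 : ℕ) * 1 := by
      rw [mul_assoc]
      exact mul_le_mul_of_nonneg_left (by linarith) hm1.le
    nlinarith
  push_cast at h6
  nlinarith

namespace ChangePointModel

variable {Ω 𝒳 Θ : Type*} [MeasurableSpace Ω] [MeasurableSpace 𝒳] [MeasurableSpace Θ]

lemma log_prod_likelihoodRatio (M : ChangePointModel Ω 𝒳 Θ) (k n : ℕ) (θ : Θ) (ω : Ω) :
    (∏ i ∈ Finset.Ico k n, M.likelihoodRatio k θ i ω).log = M.llr k n θ ω := by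
  unfold llr
  induction Finset.Ico k n using Finset.induction_on with
  | empty => simp
  | insert a s ha ih => rw [Finset.prod_insert ha, Finset.sum_insert ha, ENNReal.log_mul_add, ih]

/-- For a stopping time of the local class, the no-change probability of stopping in the first
window. -/
lemma Pinf_lt_le_of_mem_localClass (M : ChangePointModel Ω 𝒳 Θ) {β : ℝ} {ℓ m : ℕ} (hℓ : 1 ≤ ℓ)
    {τ : Ω → ℕ∞} (hτ : τ ∈ M.localClass β ℓ m) :
    M.Pinf {ω | τ ω < ((1 + m : ℕ) : ℕ∞)} ≤ ENNReal.ofReal β := by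
  have := M.isProbabilityMeasure_Pinf
  obtain ⟨hne, hle⟩ := hτ.2 1 le_rfl hℓ
  have h0 : MeasurableSet[M.filtration 0] {ω | τ ω ≤ (0 : ℕ)} := hτ.1 0
  have hbot : M.filtration 0 = ⊥ := by
    change (⨆ i : Fin 0, MeasurableSpace.comap (M.X i) inferInstance) = ⊥
    exact iSup_of_empty _
  rw [hbot, MeasurableSpace.measurableSet_bot_iff] at h0
  have hcompl : {ω | ((1 : ℕ) : ℕ∞) ≤ τ ω} = {ω | τ ω ≤ (0 : ℕ)}ᶜ := by
    ext ω
    simp [Order.one_le_iff_ne_zero]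
  have huniv : {ω | ((1 : ℕ) : ℕ∞) ≤ τ ω} = Set.univ := by
    -- `{τ ≥ 1}` belongs to the trivial σ-algebra `ℱ 0` and has positive probability, so it is
    -- everything and conditioning for `k = 1` has no effect.
    rcases h0 with h0 | h0
    · rw [hcompl, h0, Set.compl_empty]
    · rw [hcompl, h0, Set.compl_univ, measure_empty] at hne
      exact absurd rfl hne
  rwa [huniv, cond_univ] at hle

/-- The probability, under a change at `ν`, that a stopping time stops by time `ν + N`. -/
lemma P_le_add (M : ChangePointModel Ω 𝒳 Θ) {τ : Ω → ℕ∞} (hτ : IsStoppingTime M.filtration τ)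
    (ν N : ℕ) (hN : 1 ≤ N) (θ : Θ) (b : ℝ) :
    M.P ν θ {ω | τ ω ≤ ((ν + N : ℕ) : ℕ∞)} ≤
      ENNReal.ofReal (Real.exp (b * N)) * M.Pinf {ω | τ ω ≤ ((ν + N : ℕ) : ℕ∞)} +
      M.P ν θ {ω | (b : EReal) ≤
        (⨆ n ∈ Finset.Icc 1 N, M.llr ν (ν + n) θ ω) / (N : EReal)} := by
  have hB : MeasurableSet[M.filtration (ν + N)] {ω | τ ω ≤ ((ν + N : ℕ) : ℕ∞)} := hτ (ν + N)
  have hsub : {ω | τ ω ≤ ((ν + N : ℕ) : ℕ∞)} ⊆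
      ({ω | τ ω ≤ ((ν + N : ℕ) : ℕ∞)} ∩ {ω | ∏ i ∈ Finset.Ico ν (ν + N),
        M.likelihoodRatio ν θ i ω ≤ ENNReal.ofReal (Real.exp (b * N))}) ∪
      {ω | (b : EReal) ≤ (⨆ n ∈ Finset.Icc 1 N, M.llr ν (ν + n) θ ω) / (N : EReal)} := by
    intro ω hω
    by_cases h : ∏ i ∈ Finset.Ico ν (ν + N), M.likelihoodRatio ν θ i ω ≤
        ENNReal.ofReal (Real.exp (b * N))
    · exact Or.inl ⟨hω, h⟩
    · refine Or.inr ?_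
      have hlt := not_le.1 h
      rw [← ENNReal.log_lt_log_iff, ENNReal.log_ofReal_of_pos (Real.exp_pos _), Real.log_exp,
        log_prod_likelihoodRatio] at hlt
      change (b : EReal) ≤ _
      rw [EReal.le_div_iff_mul_le (by exact_mod_cast hN) (EReal.natCast_ne_top N)]
      -- Only the term `n = N` of the maximum is needed, because the change of measure is made at
      -- the fixed time `ν + N`.
      have h1 : M.llr ν (ν + N) θ ω ≤ ⨆ n ∈ Finset.Icc 1 N, M.llr ν (ν + n) θ ω :=
        le_iSup₂_of_le N (Finset.mem_Icc.2 ⟨hN, le_rfl⟩) le_rfl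
      refine le_trans ?_ (hlt.le.trans h1)
      rw [EReal.coe_mul, EReal.coe_natCast]
  have hfirst := M.P_inter_le ν (ν + N) θ hB
    (c := ENNReal.ofReal (Real.exp (b * N))) ENNReal.ofReal_ne_top
  calc _ ≤ _ := (measure_mono hsub).trans (measure_union_le _ _)
    _ ≤ _ := by gcongr

/-- A lower bound for the conditional moments of the detection delay. -/
lemma rpow_mul_le_risk (M : ChangePointModel Ω 𝒳 Θ) {τ : Ω → ℕ∞}
    (hτ : IsStoppingTime M.filtration τ) {q : ℝ} (hq : 0 < q) (ν N : ℕ) (θ : Θ) :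
    (N : ℝ≥0∞) ^ q * M.P ν θ {ω | ((ν + N : ℕ) : ℕ∞) < τ ω} ≤ M.risk q ν θ τ := by
  have := M.isProbabilityMeasure_P
  have hgt' : MeasurableSet {ω | ((ν + N : ℕ) : ℕ∞) < τ ω} :=
    M.filtration.le (ν + N) _ (hτ.measurableSet_gt (ν + N))
  unfold risk
  rw [ProbabilityTheory.cond, lintegral_smul_measure]
  calc (N : ℝ≥0∞) ^ q * M.P ν θ {ω | ((ν + N : ℕ) : ℕ∞) < τ ω}
      = ∫⁻ _ in {ω | ((ν + N : ℕ) : ℕ∞) < τ ω}, (N : ℝ≥0∞) ^ q ∂(M.P ν θ) := by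
        rw [setLIntegral_const]
    _ ≤ ∫⁻ ω in {ω | ((ν + N : ℕ) : ℕ∞) < τ ω}, ((τ ω : ℝ≥0∞) - (ν : ℝ≥0∞)) ^ q
          ∂(M.P ν θ) := by
        refine setLIntegral_mono' hgt' fun ω hω => ?_
        refine ENNReal.rpow_le_rpow ?_ hq.le
        refine ENNReal.le_sub_of_add_le_left (ENNReal.natCast_ne_top ν) ?_
        have h1 : (((ν + N : ℕ) : ℕ∞) : ℝ≥0∞) ≤ (τ ω : ℝ≥0∞) :=
          ENat.toENNReal_le.2 (le_of_lt hω)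
        simpa using h1
    _ ≤ ∫⁻ ω in {ω | (ν : ℕ∞) < τ ω}, ((τ ω : ℝ≥0∞) - (ν : ℝ≥0∞)) ^ q ∂(M.P ν θ) := by
        refine lintegral_mono_set fun ω (hω : ((ν + N : ℕ) : ℕ∞) < τ ω) => ?_
        change (ν : ℕ∞) < τ ω
        exact lt_of_le_of_lt (Nat.cast_le.2 (by omega)) hω
    _ ≤ _ := by
        rw [smul_eq_mul]
        refine le_mul_of_one_le_left zero_le ?_
        exact ENNReal.one_le_inv.2 prob_le_one

end ChangePointModel

lemma exists_lower_constant {q c : ℝ} (hc : c < 1) :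
    ∃ ε : ℝ, 0 < ε ∧ ε < 1 / 2 ∧ c < (1 - 2 * ε) ^ q * (1 - ε) := by
  have h : Tendsto (fun ε : ℝ => (1 - 2 * ε) ^ q * (1 - ε)) (𝓝[>] 0) (𝓝 1) := by
    have : ContinuousAt (fun ε : ℝ => (1 - 2 * ε) ^ q * (1 - ε)) 0 := by
      refine ContinuousAt.mul (ContinuousAt.rpow_const (by fun_prop) (Or.inl ?_)) (by fun_prop)
      norm_num
    have h2 := this.tendsto.mono_left (nhdsWithin_le_nhds (s := Set.Ioi 0))
    simpa using h2
  obtain ⟨ε, h1, h2⟩ := ((h.eventually (lt_mem_nhds hc)).and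
    (Ioo_mem_nhdsGT (show (0 : ℝ) < 1 / 2 by norm_num))).exists
  exact ⟨ε, h2.1, h2.2, h1⟩

lemma exists_upper_constant {q c : ℝ} (hc : 1 < c) :
    ∃ ε : ℝ, 0 < ε ∧ ε < 1 ∧ (1 - ε)⁻¹ * (((1 + 2 * ε) / (1 - ε)) ^ q + ε) < c := by
  have h : Tendsto (fun ε : ℝ => (1 - ε)⁻¹ * (((1 + 2 * ε) / (1 - ε)) ^ q + ε))
      (𝓝[>] 0) (𝓝 1) := by
    have : ContinuousAt (fun ε : ℝ => (1 - ε)⁻¹ * (((1 + 2 * ε) / (1 - ε)) ^ q + ε)) 0 := by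
      refine ContinuousAt.mul (ContinuousAt.inv₀ (by fun_prop) (by norm_num)) ?_
      refine ContinuousAt.add (ContinuousAt.rpow_const ?_ (Or.inl (by norm_num))) (by fun_prop)
      exact ContinuousAt.div (by fun_prop) (by fun_prop) (by norm_num)
    have h2 := this.tendsto.mono_left (nhdsWithin_le_nhds (s := Set.Ioi 0))
    simpa using h2
  obtain ⟨ε, h1, h2⟩ := ((h.eventually (gt_mem_nhds hc)).and
    (Ioo_mem_nhdsGT (show (0 : ℝ) < 1 by norm_num))).exists
  exact ⟨ε, h2.1, h2.2, h1⟩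

namespace ChangePointModel

variable {Ω 𝒳 Θ : Type*} [MeasurableSpace Ω] [MeasurableSpace 𝒳] [MeasurableSpace Θ]

/-- The asymptotic lower bound for the risk, uniformly over the local class. -/
lemma eventually_mul_le_risk (M : ChangePointModel Ω 𝒳 Θ) {ϱ₁ δ : ℝ → ℝ} {ℓ m : ℝ → ℕ}
    (hrates : AdmissibleRates ϱ₁ δ) (hℓ : ∀ β, 0 < β → β < 1 → 1 ≤ ℓ β) (H1 : CondHOne ϱ₁ m)
    {I : Θ → ℝ} (hI : M.RightTail I) {q : ℝ} (hq : 0 < q) (ν : ℕ) (θ : Θ) {c : ℝ} (hc : c < 1) :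
    ∀ᶠ β in 𝓝[>] 0, ∀ τ ∈ M.localClass β (ℓ β) (m β),
      ENNReal.ofReal c * ENNReal.ofReal ((|Real.log β| / I θ) ^ q) ≤ M.risk q ν θ τ := by
  have := M.isProbabilityMeasure_P
  obtain ⟨ε, hε0, hε1, hεc⟩ := exists_lower_constant (q := q) hc
  obtain ⟨hIpos, htail⟩ := hI θ
  -- With `b = (1 + ε) I` the exponent in `P_le_add` is at most `(1 - ε²)|log β|`, so the factor `β`
  -- still wins.
  let N : ℝ → ℕ := fun β => ⌊(1 - ε) * |Real.log β| / I θ⌋₊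
  have hNtop : Tendsto N (𝓝[>] 0) atTop := by
    refine tendsto_nat_floor_atTop.comp (Tendsto.atTop_div_const hIpos ?_)
    exact tendsto_abs_log_atTop.const_mul_atTop (by linarith)
  have htail' := ((htail ν ε hε0).comp hNtop).eventually
    (gt_mem_nhds (show (0 : ℝ≥0∞) < ENNReal.ofReal (ε / 2) by
      rw [ENNReal.ofReal_pos]; positivity))
  have hexp : Tendsto (fun β : ℝ => Real.exp (-(ε ^ 2 * |Real.log β|))) (𝓝[>] 0) (𝓝 0) :=
    Real.tendsto_exp_neg_atTop_nhds_zero.comp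
      (tendsto_abs_log_atTop.const_mul_atTop (by positivity))
  filter_upwards [eventually_mem_unit_interval, htail', hNtop.eventually_ge_atTop 1,
    hexp.eventually (gt_mem_nhds (show (0 : ℝ) < ε / 2 by positivity)),
    -- In the constant, `1 / I θ` pays for `N` and the extra `1` for the fixed `ν ≤ |log β|`.
    CondHOne.eventually_mul_abs_log_le hrates H1 (C := 1 / I θ + 1) (by positivity),
    tendsto_abs_log_atTop.eventually_ge_atTop (ν : ℝ),
    -- This absorbs the unit lost in the floor, at the price of `1 - 2ε` instead of `1 - ε`.
    tendsto_abs_log_atTop.eventually_ge_atTop (I θ / ε)]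
    with β hβ htailβ hN1 hexpβ hmβ hνβ hLβ τ hτ
  have hLpos : 0 < |Real.log β| := by
    rw [abs_pos]; exact (Real.log_neg hβ.1 hβ.2).ne
  have hx0 : 0 ≤ (1 - ε) * |Real.log β| / I θ := by
    have : 0 < 1 - ε := by linarith
    positivity
  have hNle : (N β : ℝ) ≤ (1 - ε) * |Real.log β| / I θ := Nat.floor_le hx0
  have hNge : (1 - 2 * ε) * (|Real.log β| / I θ) ≤ N β := by
    have h1 : (1 - ε) * |Real.log β| / I θ < N β + 1 := Nat.lt_floor_add_one _
    have h2 : 1 ≤ ε * (|Real.log β| / I θ) := by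
      rw [div_le_iff₀ hε0] at hLβ
      rw [← mul_div_assoc, le_div_iff₀ hIpos]
      linarith
    rw [mul_div_assoc] at h1
    linarith
  have hwin : ν + N β < 1 + m β := by
    have h1 : (N β : ℝ) ≤ 1 / I θ * |Real.log β| := by
      refine hNle.trans ?_
      rw [div_mul_eq_mul_div, one_mul]
      gcongr
      nlinarith
    have h2 : ((ν + N β : ℕ) : ℝ) ≤ m β := by push_cast; linarith
    have h3 : ν + N β ≤ m β := by exact_mod_cast h2
    omega
  have hPinf : M.Pinf {ω | τ ω ≤ ((ν + N β : ℕ) : ℕ∞)} ≤ ENNReal.ofReal β := by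
    refine le_trans (measure_mono ?_)
      (M.Pinf_lt_le_of_mem_localClass (hℓ β hβ.1 hβ.2) hτ)
    intro ω (hω : τ ω ≤ _)
    exact hω.trans_lt (Nat.cast_lt.2 hwin)
  have hearly : M.P ν θ {ω | τ ω ≤ ((ν + N β : ℕ) : ℕ∞)} ≤ ENNReal.ofReal ε := by
    have h1 := M.P_le_add hτ.1 ν (N β) hN1 θ ((1 + ε) * I θ)
    have h2 : ENNReal.ofReal (Real.exp ((1 + ε) * I θ * N β)) * ENNReal.ofReal β ≤
        ENNReal.ofReal (ε / 2) := by
      rw [← ENNReal.ofReal_mul (Real.exp_pos _).le]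
      refine ENNReal.ofReal_le_ofReal (le_trans ?_ hexpβ.le)
      have h3 : β = Real.exp (-|Real.log β|) := by
        rw [abs_log_of_lt_one hβ.1 hβ.2, neg_neg, Real.exp_log hβ.1]
      have h4 : Real.exp ((1 + ε) * I θ * N β) * β =
          Real.exp ((1 + ε) * I θ * N β + -|Real.log β|) := by
        rw [Real.exp_add, ← h3]
      rw [h4, Real.exp_le_exp]
      rw [le_div_iff₀ hIpos] at hNle
      nlinarith
    calc _ ≤ _ := h1
      _ ≤ ENNReal.ofReal (ε / 2) + ENNReal.ofReal (ε / 2) := by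
          refine add_le_add ((mul_le_mul_right hPinf _).trans h2) htailβ.le
      _ = ENNReal.ofReal ε := by
          rw [← ENNReal.ofReal_add (by positivity) (by positivity), add_halves]
  have hgt : ENNReal.ofReal (1 - ε) ≤ M.P ν θ {ω | ((ν + N β : ℕ) : ℕ∞) < τ ω} := by
    have hmeas : MeasurableSet {ω | τ ω ≤ ((ν + N β : ℕ) : ℕ∞)} :=
      M.filtration.le _ _ (hτ.1 (ν + N β))
    have hcompl : {ω | ((ν + N β : ℕ) : ℕ∞) < τ ω} = {ω | τ ω ≤ ((ν + N β : ℕ) : ℕ∞)}ᶜ := by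
      ext ω; simp
    rw [hcompl, prob_compl_eq_one_sub hmeas, ENNReal.ofReal_sub _ hε0.le, ENNReal.ofReal_one]
    exact tsub_le_tsub_left hearly 1
  refine le_trans ?_ (M.rpow_mul_le_risk hτ.1 hq ν (N β) θ)
  have hv : 0 ≤ |Real.log β| / I θ := by positivity
  calc ENNReal.ofReal c * ENNReal.ofReal ((|Real.log β| / I θ) ^ q)
      ≤ ENNReal.ofReal ((1 - 2 * ε) ^ q * (1 - ε)) *
        ENNReal.ofReal ((|Real.log β| / I θ) ^ q) := by gcongr
    _ = ENNReal.ofReal (((1 - 2 * ε) * (|Real.log β| / I θ)) ^ q) * ENNReal.ofReal (1 - ε) := by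
        rw [← ENNReal.ofReal_mul' (by positivity), ← ENNReal.ofReal_mul' (by linarith),
          Real.mul_rpow (by linarith) hv]
        congr 1
        ring
    _ ≤ _ := by
        gcongr
        rw [← ENNReal.ofReal_natCast, ENNReal.ofReal_rpow_of_nonneg (by positivity) hq.le]
        refine ENNReal.ofReal_le_ofReal (Real.rpow_le_rpow ?_ hNge hq.le)
        exact mul_nonneg (by linarith) hv

end ChangePointModel

/-! ### Moments through tail sums and the upper bound for the risk. -/

lemma add_one_rpow_le {q r x : ℝ} (hqr : q ≤ r) (hr : 1 ≤ r) (hx : 1 ≤ x) :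
    (x + 1) ^ q ≤ x ^ q + 2 ^ r * x ^ (r - 1) := by
  have hx0 : 0 < x := by linarith
  have hy0 : 0 < 1 / x := by positivity
  have hy1 : 1 / x ≤ 1 := (div_le_one hx0).2 hx
  -- Convexity of the `r`-th power: `1 + 1 / x` is a convex combination of `1` and `2` with weight
  -- `1 / x` on `2`.
  have hconv : (1 + 1 / x) ^ r ≤ 1 + 2 ^ r * (1 / x) := by
    have h := (convexOn_rpow hr).2 (show (1 : ℝ) ∈ Set.Ici 0 by simp)
      (show (2 : ℝ) ∈ Set.Ici 0 by simp) (show 0 ≤ 1 - 1 / x by linarith) hy0.le (by ring)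
    simp only [smul_eq_mul, mul_one, Real.one_rpow] at h
    have h2 : 1 - 1 / x + 1 / x * 2 = 1 + 1 / x := by ring
    rw [h2] at h
    linarith
  have hle : (1 + 1 / x) ^ q ≤ 1 + 2 ^ r * (1 / x) :=
    (Real.rpow_le_rpow_of_exponent_le (by linarith) hqr).trans hconv
  have hxq : x ^ q ≤ x ^ r := Real.rpow_le_rpow_of_exponent_le hx hqr
  have h3 : (x + 1) ^ q = x ^ q * (1 + 1 / x) ^ q := by
    rw [← Real.mul_rpow hx0.le (by positivity)]
    congr 1
    field_simp
  have h4 : x ^ (r - 1) = x ^ r * (1 / x) := by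
    rw [Real.rpow_sub_one hx0.ne']; ring
  have h5 : 0 < x ^ q := by positivity
  have h6 : 0 < (2 : ℝ) ^ r * (1 / x) := by positivity
  rw [h3, h4]
  calc x ^ q * (1 + 1 / x) ^ q ≤ x ^ q * (1 + 2 ^ r * (1 / x)) := by gcongr
    _ = x ^ q + x ^ q * (2 ^ r * (1 / x)) := by ring
    _ ≤ x ^ q + x ^ r * (2 ^ r * (1 / x)) := by gcongr
    _ = _ := by ring

lemma ENNReal.natCast_add_one_rpow_le {q r : ℝ} (hq : 0 < q) (hqr : q ≤ r) (hr : 1 ≤ r) {n : ℕ}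
    (hn : 1 ≤ n) :
    ((n + 1 : ℕ) : ℝ≥0∞) ^ q ≤ (n : ℝ≥0∞) ^ q + 2 ^ r * (n : ℝ≥0∞) ^ (r - 1) := by
  have hn' : (1 : ℝ) ≤ n := by exact_mod_cast hn
  have h := ENNReal.ofReal_le_ofReal (add_one_rpow_le hqr hr hn')
  rw [ENNReal.ofReal_add (by positivity) (by positivity), ENNReal.ofReal_mul (by positivity),
    ← ENNReal.ofReal_rpow_of_nonneg (by positivity) hq.le,
    ← ENNReal.ofReal_rpow_of_nonneg (by positivity) hq.le,
    ← ENNReal.ofReal_rpow_of_nonneg (by positivity) (by linarith),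
    ← ENNReal.ofReal_rpow_of_nonneg (by positivity) (by linarith),
    ENNReal.ofReal_natCast, ENNReal.ofReal_ofNat] at h
  refine le_trans (le_of_eq ?_) h
  congr 1
  rw [← ENNReal.ofReal_natCast]
  push_cast
  rfl

/-- Summation by parts: a moment is bounded by a truncation level plus a weighted sum of tails. -/
lemma ENat.toENNReal_rpow_le_add_tsum {q r : ℝ} (hq : 0 < q) (hqr : q ≤ r) (hr : 1 ≤ r) {N : ℕ}
    (hN : 1 ≤ N) (y : ℕ∞) :
    (y : ℝ≥0∞) ^ q ≤ (N : ℝ≥0∞) ^ q + 2 ^ r * ∑' n : ℕ,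
      if N ≤ n + 1 ∧ ((n + 1 : ℕ) : ℕ∞) < y then ((n + 1 : ℕ) : ℝ≥0∞) ^ (r - 1) else 0 := by
  have h2r : (2 : ℝ≥0∞) ^ r ≠ 0 := by
    simp [ENNReal.rpow_eq_zero_iff]
  have hr1 : 0 ≤ r - 1 := by linarith
  induction y with
  | top =>
    -- For infinite delay the series diverges, since `r ≥ 1` keeps its terms from `N` on at least
    -- `1`; no almost sure finiteness is required.
    have htop : ∑' n : ℕ, (if N ≤ n + 1 ∧ ((n + 1 : ℕ) : ℕ∞) < (⊤ : ℕ∞) then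
        ((n + 1 : ℕ) : ℝ≥0∞) ^ (r - 1) else 0) = ∞ := by
      rw [eq_top_iff]
      calc (∞ : ℝ≥0∞) = ∑' _ : ℕ, 1 := (ENNReal.tsum_const_eq_top_of_ne_zero one_ne_zero).symm
        _ ≤ ∑' n : ℕ, (if N ≤ (n + N) + 1 ∧ (((n + N) + 1 : ℕ) : ℕ∞) < (⊤ : ℕ∞) then
            (((n + N) + 1 : ℕ) : ℝ≥0∞) ^ (r - 1) else 0) := by
            refine ENNReal.tsum_le_tsum fun n => ?_
            rw [if_pos ⟨by omega, ENat.natCast_lt_top _⟩]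
            rw [← ENNReal.one_rpow (r - 1)]
            refine ENNReal.rpow_le_rpow ?_ hr1
            exact_mod_cast Nat.le_add_left 1 (n + N)
        _ ≤ _ := ENNReal.tsum_comp_le_tsum_of_injective (add_left_injective N) _
    rw [htop, ENNReal.mul_top h2r, add_top]
    exact le_top
  | coe y =>
    rcases le_or_gt y N with hy | hy
    · refine le_add_right (ENNReal.rpow_le_rpow ?_ hq.le)
      simpa using hy
    · have hind : ∀ y : ℕ, N ≤ y → ((y : ℕ) : ℝ≥0∞) ^ q ≤ (N : ℝ≥0∞) ^ q +
          2 ^ r * ∑ n ∈ Finset.Ico N y, (n : ℝ≥0∞) ^ (r - 1) := by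
        intro y hy
        induction y, hy using Nat.le_induction with
        | base => simp
        | succ y hy ih =>
          rw [Finset.sum_Ico_succ_top hy, mul_add, ← add_assoc]
          exact (ENNReal.natCast_add_one_rpow_le hq hqr hr (hN.trans hy)).trans
            (add_le_add_left ih _)
      have h1 := hind y hy.le
      simp only [ENat.toENNReal_coe]
      refine h1.trans ?_
      gcongr
      have hIco : ∑ n ∈ Finset.Ico N y, (n : ℝ≥0∞) ^ (r - 1) =
          ∑ n ∈ Finset.Ico (N - 1) (y - 1), ((n + 1 : ℕ) : ℝ≥0∞) ^ (r - 1) := by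
        have := Finset.sum_Ico_add' (fun n : ℕ => (n : ℝ≥0∞) ^ (r - 1)) (N - 1) (y - 1) 1
        rw [this]
        congr 2 <;> omega
      rw [hIco]
      refine le_trans (Finset.sum_le_sum fun n hn => ?_) (ENNReal.sum_le_tsum _)
      rw [Finset.mem_Ico] at hn
      rw [if_pos ⟨by omega, by rw [Nat.cast_lt]; omega⟩]

namespace ChangePointModel

variable {Ω 𝒳 Θ : Type*} [MeasurableSpace Ω] [MeasurableSpace 𝒳] [MeasurableSpace Θ]

section

variable [PseudoMetricSpace Θ] [OpensMeasurableSpace Θ]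

/-- If the log-likelihood ratios are large on a ball around `θ`, the WSR procedure has stopped. -/
lemma iInf_llr_lt_of_lt_wsrTime (M : ChangePointModel Ω 𝒳 Θ) (W : Measure Θ)
    {θ : Θ} {δ : ℝ} {w : ℝ} (hw : 0 < w) (hwW : ENNReal.ofReal w ≤ W (Metric.ball θ δ))
    {a b : ℝ} {ν n : ℕ} (hn : 1 ≤ n) (hab : a - Real.log w ≤ b * n) {ω : Ω}
    (hω : ((ν + n : ℕ) : ℕ∞) < M.wsrTime W a ω) :
    (⨅ u ∈ Metric.ball θ δ, M.llr ν (ν + n) u ω) / (n : EReal) < (b : EReal) := by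
  by_contra hcon
  rw [not_lt, EReal.le_div_iff_mul_le (by exact_mod_cast hn) (EReal.natCast_ne_top n),
    ← EReal.coe_natCast, ← EReal.coe_mul] at hcon
  refine absurd hω (not_lt.2 ((M.wsrTime_le_iff W a (ν + n) ω).2 ⟨ν + n, le_rfl, by omega, ?_⟩))
  -- Keep only the term of the true change point and only the ball: the prior mass `w` costs `log w`
  -- in the threshold.
  calc ENNReal.ofReal (Real.exp a) ≤ ENNReal.ofReal (Real.exp (b * n)) * ENNReal.ofReal w := by
        rw [← ENNReal.ofReal_mul (Real.exp_pos _).le]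
        refine ENNReal.ofReal_le_ofReal ?_
        nth_rw 1 [← Real.exp_log hw]
        rw [← Real.exp_add, Real.exp_le_exp]
        linarith
    _ ≤ ENNReal.ofReal (Real.exp (b * n)) * W (Metric.ball θ δ) := by gcongr
    _ = ∫⁻ _ in Metric.ball θ δ, ENNReal.ofReal (Real.exp (b * n)) ∂W := by
        rw [setLIntegral_const]
    _ ≤ ∫⁻ u in Metric.ball θ δ, ∏ i ∈ Finset.Ico ν (ν + n), M.likelihoodRatio ν u i ω ∂W := by
        refine setLIntegral_mono' Metric.isOpen_ball.measurableSet fun u hu => ?_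
        rw [← coe_le_log_iff, log_prod_likelihoodRatio]
        exact hcon.trans (iInf₂_le u hu)
    _ ≤ M.weightedLR W ν (ν + n) ω := setLIntegral_le_lintegral _ _
    _ ≤ M.wsrStat W (ν + n) ω :=
        Finset.single_le_sum (f := fun k => M.weightedLR W k (ν + n) ω)
          (fun _ _ => zero_le) (Finset.mem_range.2 (by omega))

/-- A bound on the unconditional moments of the detection delay of the WSR procedure. -/
lemma lintegral_wsrTime_sub_le (M : ChangePointModel Ω 𝒳 Θ) (W : Measure Θ) [SFinite W]
    (I : Θ → ℝ) {q r : ℝ} (hq : 0 < q) (hqr : q ≤ r) (hr : 1 ≤ r)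
    {θ : Θ} {δ ε : ℝ} {w : ℝ} (hw : 0 < w) (hwW : ENNReal.ofReal w ≤ W (Metric.ball θ δ))
    {a : ℝ} (ν : ℕ) {N : ℕ} (hN : 1 ≤ N) (hε : ε ≤ I θ) (ha : a - Real.log w ≤ (I θ - ε) * N) :
    ∫⁻ ω, ((M.wsrTime W a ω : ℝ≥0∞) - (ν : ℝ≥0∞)) ^ q ∂(M.P ν θ) ≤
      (N : ℝ≥0∞) ^ q + 2 ^ r * M.leftTailSum I r ε θ δ := by
  have := M.isProbabilityMeasure_P
  have hst := M.isStoppingTime_wsrTime W a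
  have hmeas : ∀ n : ℕ,
      MeasurableSet {ω | N ≤ n + 1 ∧ ((ν + (n + 1) : ℕ) : ℕ∞) < M.wsrTime W a ω} := fun n =>
    (MeasurableSet.const _).inter (M.filtration.le _ _ (hst.measurableSet_gt (ν + (n + 1))))
  let g : ℕ → Ω → ℝ≥0∞ := fun n =>
    {ω | N ≤ n + 1 ∧ ((ν + (n + 1) : ℕ) : ℕ∞) < M.wsrTime W a ω}.indicator
      fun _ => ((n + 1 : ℕ) : ℝ≥0∞) ^ (r - 1)
  have hg : ∀ n, Measurable (g n) := fun n => measurable_const.indicator (hmeas n)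
  calc _ ≤ ∫⁻ ω, (N : ℝ≥0∞) ^ q + 2 ^ r * ∑' n, g n ω ∂(M.P ν θ) := by
        refine lintegral_mono fun ω => ?_
        have h := ENat.toENNReal_rpow_le_add_tsum hq hqr hr hN (M.wsrTime W a ω - (ν : ℕ∞))
        rw [ENat.toENNReal_sub, ENat.toENNReal_coe] at h
        refine h.trans (le_of_eq ?_)
        congr 3
        ext n
        simp only [g, Set.indicator_apply, Set.mem_ofPred_eq, lt_tsub_iff_left, Nat.cast_add]
    _ = (N : ℝ≥0∞) ^ q + 2 ^ r * ∑' n, ∫⁻ ω, g n ω ∂(M.P ν θ) := by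
        rw [lintegral_add_left measurable_const, lintegral_const, measure_univ, mul_one,
          lintegral_const_mul _ (Measurable.tsum hg),
          lintegral_tsum fun n => (hg n).aemeasurable]
    _ ≤ _ := by
        gcongr
        refine ENNReal.tsum_le_tsum fun n => ?_
        rw [lintegral_indicator_const (hmeas n)]
        gcongr
        refine le_iSup_of_le ν (measure_mono ?_)
        rintro ω ⟨hn, hω⟩
        refine M.iInf_llr_lt_of_lt_wsrTime W hw hwW (by omega) (ha.trans ?_) hω
        have : (N : ℝ) ≤ ((n + 1 : ℕ) : ℝ) := by exact_mod_cast hn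
        -- As `I θ - ε ≥ 0`, the threshold condition at `N` persists for all later times, which is
        -- why the tails start at `N`.
        exact mul_le_mul_of_nonneg_left this (by linarith)

end

/-- The conditional risk is bounded by the unconditional moment divided by the no-change
probability of not stopping before the change. -/
lemma risk_le_inv_mul (M : ChangePointModel Ω 𝒳 Θ) {τ : Ω → ℕ∞}
    (hτ : IsStoppingTime M.filtration τ) (q : ℝ) (ν : ℕ) (θ : Θ) {p : ℝ}
    (hp : M.Pinf {ω | τ ω ≤ (ν : ℕ∞)} ≤ ENNReal.ofReal p) (hp0 : 0 ≤ p) :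
    M.risk q ν θ τ ≤ (ENNReal.ofReal (1 - p))⁻¹ *
      ∫⁻ ω, ((τ ω : ℝ≥0∞) - (ν : ℝ≥0∞)) ^ q ∂(M.P ν θ) := by
  have := M.isProbabilityMeasure_Pinf
  have hle : MeasurableSet[M.filtration ν] {ω | τ ω ≤ (ν : ℕ∞)} := hτ ν
  have hcompl : {ω | (ν : ℕ∞) < τ ω} = {ω | τ ω ≤ (ν : ℕ∞)}ᶜ := by ext ω; simp
  have hP : ENNReal.ofReal (1 - p) ≤ M.P ν θ {ω | (ν : ℕ∞) < τ ω} := by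
    -- Not stopping by `ν` is an event of `ℱ ν`, where the measure has not yet changed.
    rw [hcompl, M.P_eq_Pinf ν θ hle.compl, prob_compl_eq_one_sub (M.filtration.le _ _ hle),
      ENNReal.ofReal_sub _ hp0, ENNReal.ofReal_one]
    exact tsub_le_tsub_left hp 1
  unfold risk
  rw [ProbabilityTheory.cond, lintegral_smul_measure, smul_eq_mul]
  exact mul_le_mul' (ENNReal.inv_le_inv.2 hP) (setLIntegral_le_lintegral _ _)

end ChangePointModel

lemma wsrThreshold_le {α ϱ₁ δ : ℝ} (hα0 : 0 < α) (hα1 : α < 1) (hϱ : 0 < ϱ₁) (hδ : 0 < δ) :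
    wsrThreshold α (δ * ϱ₁) ≤ |Real.log α| + (|Real.log ϱ₁| + |Real.log δ|) := by
  unfold wsrThreshold
  rw [Real.log_div (by linarith) (by positivity), Real.log_mul (by positivity) hα0.ne',
    Real.log_mul hδ.ne' hϱ.ne']
  have h1 : Real.log (1 - α) ≤ 0 := Real.log_nonpos (by linarith) (by linarith)
  have h2 := neg_abs_le (Real.log α)
  have h3 := neg_abs_le (Real.log ϱ₁)
  have h4 := neg_abs_le (Real.log δ)
  linarith

/-- The threshold is asymptotically at most `|log β|`. -/
lemma eventually_wsrThreshold_le {ϱ₁ δ : ℝ → ℝ} {ℓ m : ℝ → ℕ} (hrates : AdmissibleRates ϱ₁ δ)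
    (H2 : CondHTwo (fun β => δ β * ϱ₁ β) ℓ m) {ε : ℝ} (hε : 0 < ε) :
    ∀ᶠ β in 𝓝[>] 0, wsrThreshold (alphaTwo β (δ β * ϱ₁ β) (ℓ β) (m β)) (δ β * ϱ₁ β) ≤
      (1 + ε) * |Real.log β| := by
  have h := H2.1.add hrates.2.2
  rw [add_zero] at h
  filter_upwards [eventually_mem_unit_interval,
    h.eventually (gt_mem_nhds (show (1 : ℝ) < 1 + ε by linarith))] with β hβ hlt
  obtain ⟨⟨hϱ0, hϱ1⟩, hδ0, hδ1⟩ := hrates.1 β hβ.1 hβ.2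
  have h0 : 0 < δ β * ϱ₁ β := mul_pos hδ0 hϱ0
  have h1 : δ β * ϱ₁ β < 1 := by nlinarith
  have hL : 0 < |Real.log β| := abs_pos.2 (Real.log_neg hβ.1 hβ.2).ne
  refine (wsrThreshold_le (alphaTwo_pos hβ.1 h1 _ _)
    ((alphaTwo_lt hβ.1 h0 h1 _ _).trans hβ.2) hϱ0 hδ0).trans ?_
  rw [← add_div, div_lt_iff₀ hL] at hlt
  exact hlt.le

/-- Under (H₂) the false alarm bound of the WSR procedure up to time `k*` vanishes. -/
lemma eventually_div_exp_wsrThreshold_le {ϱ₁ δ : ℝ → ℝ} {ℓ m : ℝ → ℕ}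
    (hrates : AdmissibleRates ϱ₁ δ) (H2 : CondHTwo (fun β => δ β * ϱ₁ β) ℓ m) {ε : ℝ}
    (hε : 0 < ε) :
    ∀ᶠ β in 𝓝[>] 0, ((ℓ β + m β : ℕ) : ℝ) /
      Real.exp (wsrThreshold (alphaTwo β (δ β * ϱ₁ β) (ℓ β) (m β)) (δ β * ϱ₁ β)) ≤ ε := by
  -- `β < 1 / 2` gives `1 - α₂ > 1 / 2`, which explains the bound `ε / 2` on `α₂ ϱ₂ k*`.
  filter_upwards [eventually_mem_unit_interval, Ioo_mem_nhdsGT (show (0 : ℝ) < 1 / 2 by norm_num),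
    H2.2.eventually (gt_mem_nhds (show (0 : ℝ) < ε / 2 by linarith))] with β hβ hβ2 hlt
  obtain ⟨⟨hϱ0, hϱ1⟩, hδ0, hδ1⟩ := hrates.1 β hβ.1 hβ.2
  have h0 : 0 < δ β * ϱ₁ β := mul_pos hδ0 hϱ0
  have h1 : δ β * ϱ₁ β < 1 := by nlinarith
  have hα0 := alphaTwo_pos hβ.1 h1 (ℓ β) (m β)
  have hα1 := (alphaTwo_lt hβ.1 h0 h1 (ℓ β) (m β)).trans hβ2.2
  rw [exp_wsrThreshold hα0 (by linarith) h0, div_div_eq_mul_div, div_le_iff₀ (by linarith)]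
  nlinarith

namespace ChangePointModel

variable {Ω 𝒳 Θ : Type*} [MeasurableSpace Ω] [MeasurableSpace 𝒳] [MeasurableSpace Θ]

lemma exists_leftTailSum_ne_top [PseudoMetricSpace Θ] {M : ChangePointModel Ω 𝒳 Θ} {I : Θ → ℝ}
    {r : ℝ} (hI : M.LeftTail I r) (θ : Θ) {ε : ℝ} (hε : 0 < ε) :
    ∃ δ : ℝ, 0 < δ ∧ M.leftTailSum I r ε θ δ ≠ ∞ := by
  obtain ⟨Υ, hΥ, hlim⟩ := (hI.2 θ).2 ε hε
  obtain ⟨δ, h1, h2⟩ := ((hlim.eventually (gt_mem_nhds hΥ.lt_top)).and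
    self_mem_nhdsWithin).exists
  exact ⟨δ, h2, h1.ne⟩

/-- The asymptotic upper bound for the risk of the WSR procedure, uniformly in the change
point. -/
lemma eventually_risk_wsrTime_le [PseudoMetricSpace Θ] [OpensMeasurableSpace Θ]
    (M : ChangePointModel Ω 𝒳 Θ) (W : Measure Θ) [IsProbabilityMeasure W]
    (hW : ∀ (θ : Θ) (δ : ℝ), 0 < δ → 0 < W (Metric.ball θ δ))
    {ϱ₁ δ : ℝ → ℝ} {ℓ m : ℝ → ℕ} (hrates : AdmissibleRates ϱ₁ δ)
    (H2 : CondHTwo (fun β => δ β * ϱ₁ β) ℓ m) {I : Θ → ℝ} {q r : ℝ} (hr : 1 ≤ r)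
    (hI : M.LeftTail I r) (hq : 0 < q) (hqr : q ≤ r) (θ : Θ) {c : ℝ} (hc : 1 < c) :
    ∀ᶠ β in 𝓝[>] 0, ∀ ν ≤ ℓ β + m β,
      M.risk q ν θ
        (M.wsrTime W (wsrThreshold (alphaTwo β (δ β * ϱ₁ β) (ℓ β) (m β)) (δ β * ϱ₁ β))) ≤
      ENNReal.ofReal c * ENNReal.ofReal ((|Real.log β| / I θ) ^ q) := by
  obtain ⟨ε, hε0, hε1, hεc⟩ := exists_upper_constant (q := q) hc
  have hIpos := (hI.2 θ).1
  have hε1' : 0 < 1 - ε := by linarith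
  -- The slack is relative, `ε * I θ`, so the drift on the ball is `I θ * (1 - ε)`. The radius `η`
  -- depends on `ε` but not on `β` or `ν`, so the series is a fixed constant.
  obtain ⟨η, hη, hS⟩ := exists_leftTailSum_ne_top hI θ (mul_pos hε0 hIpos)
  let w : ℝ := (W (Metric.ball θ η)).toReal
  have hw : 0 < w := ENNReal.toReal_pos (hW θ η hη).ne' (measure_ne_top _ _)
  have hwW : ENNReal.ofReal w ≤ W (Metric.ball θ η) := ENNReal.ofReal_toReal_le
  have hw1 : w ≤ 1 := ENNReal.toReal_le_of_le_ofReal zero_le_one (by simpa using prob_le_one)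
  have hlogw : Real.log w ≤ 0 := Real.log_nonpos hw.le hw1
  set S : ℝ := (2 ^ r * M.leftTailSum I r (ε * I θ) θ η).toReal with hSdef
  have hSeq : 2 ^ r * M.leftTailSum I r (ε * I θ) θ η = ENNReal.ofReal S := by
    rw [hSdef, ENNReal.ofReal_toReal]
    exact ENNReal.mul_ne_top (ENNReal.rpow_ne_top_of_nonneg (by linarith) (by simp)) hS
  have hpow : Tendsto (fun β : ℝ => ε * (|Real.log β| / I θ) ^ q) (𝓝[>] 0) atTop :=
    ((tendsto_rpow_atTop hq).comp
      (tendsto_abs_log_atTop.atTop_div_const hIpos)).const_mul_atTop hε0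
  have hlin : Tendsto (fun β : ℝ => ε * |Real.log β|) (𝓝[>] 0) atTop :=
    tendsto_abs_log_atTop.const_mul_atTop hε0
  filter_upwards [eventually_mem_unit_interval, eventually_wsrThreshold_le hrates H2 hε0,
    eventually_div_exp_wsrThreshold_le hrates H2 hε0, hpow.eventually_ge_atTop S,
    -- This extra `ε |log β|` absorbs both `-log w` and the rounding `⌈y⌉ + 1 ≤ y + 2`, turning `1 +
    -- ε` into `1 + 2ε`.
    hlin.eventually_ge_atTop (2 * (I θ * (1 - ε)) - Real.log w)]
    with β hβ haβ hkβ hSβ hLβ ν hν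
  have hL : 0 < |Real.log β| := abs_pos.2 (Real.log_neg hβ.1 hβ.2).ne
  set a := wsrThreshold (alphaTwo β (δ β * ϱ₁ β) (ℓ β) (m β)) (δ β * ϱ₁ β)
  set L := |Real.log β|
  set y : ℝ := ((1 + ε) * L - Real.log w) / (I θ * (1 - ε)) with hy
  have hden : 0 < I θ * (1 - ε) := mul_pos hIpos hε1'
  have hy0 : 0 ≤ y := div_nonneg (by nlinarith) hden.le
  have hyN : y ≤ (⌈y⌉₊ + 1 : ℕ) := (Nat.le_ceil y).trans (by push_cast; linarith)
  have hNle : ((⌈y⌉₊ + 1 : ℕ) : ℝ) ≤ (1 + 2 * ε) / (1 - ε) * (L / I θ) := by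
    have h1 : ((⌈y⌉₊ + 1 : ℕ) : ℝ) ≤ y + 2 := by
      have := Nat.ceil_lt_add_one hy0
      push_cast
      linarith
    refine h1.trans ?_
    rw [div_mul_div_comm, mul_comm (1 - ε), le_div_iff₀ hden, add_mul, hy,
      div_mul_cancel₀ _ hden.ne']
    linarith
  have hmom := M.lintegral_wsrTime_sub_le W I hq hqr hr (ε := ε * I θ) hw hwW (a := a) ν
    (N := ⌈y⌉₊ + 1) (by omega) (by nlinarith) (by
      rw [hy, div_le_iff₀ hden] at hyN
      nlinarith)
  have hPinf : M.Pinf {ω | M.wsrTime W a ω ≤ (ν : ℕ∞)} ≤ ENNReal.ofReal ε := by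
    refine (M.Pinf_wsrTime_le W a ν).trans (ENNReal.ofReal_le_ofReal (le_trans ?_ hkβ))
    gcongr
  have hv : 0 ≤ L / I θ := by positivity
  have hbase : 0 ≤ (1 + 2 * ε) / (1 - ε) := by positivity
  calc _ ≤ _ := M.risk_le_inv_mul (M.isStoppingTime_wsrTime W a) q ν θ hPinf hε0.le
    _ ≤ (ENNReal.ofReal (1 - ε))⁻¹ *
        (ENNReal.ofReal (((1 + 2 * ε) / (1 - ε) * (L / I θ)) ^ q) +
          ENNReal.ofReal (ε * (L / I θ) ^ q)) := by
        refine mul_le_mul_right (hmom.trans (add_le_add ?_ ?_)) _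
        · rw [← ENNReal.ofReal_natCast, ENNReal.ofReal_rpow_of_nonneg (by positivity) hq.le]
          exact ENNReal.ofReal_le_ofReal (Real.rpow_le_rpow (by positivity) hNle hq.le)
        · rw [hSeq]
          exact ENNReal.ofReal_le_ofReal hSβ
    _ = ENNReal.ofReal ((1 - ε)⁻¹ * (((1 + 2 * ε) / (1 - ε)) ^ q + ε)) *
          ENNReal.ofReal ((L / I θ) ^ q) := by
        rw [← ENNReal.ofReal_inv_of_pos hε1', ← ENNReal.ofReal_add (by positivity) (by positivity),
          ← ENNReal.ofReal_mul (by positivity), ← ENNReal.ofReal_mul (by positivity),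
          Real.mul_rpow hbase hv]
        congr 1
        ring
    _ ≤ _ := by gcongr

end ChangePointModel

/-! ### From two-sided bounds to asymptotic equivalence; the theorem. -/

lemma asympEquiv_of_eventually_le {u v : ℝ → ℝ≥0∞}
    (hv0 : ∀ᶠ β in 𝓝[>] 0, v β ≠ 0) (hv : ∀ᶠ β in 𝓝[>] 0, v β ≠ ∞)
    (hl : ∀ c : ℝ, c < 1 → ∀ᶠ β in 𝓝[>] 0, ENNReal.ofReal c * v β ≤ u β)
    (hu : ∀ c : ℝ, 1 < c → ∀ᶠ β in 𝓝[>] 0, u β ≤ ENNReal.ofReal c * v β) :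
    AsympEquiv u v := by
  refine tendsto_order.2 ⟨fun b hb => ?_, fun b hb => ?_⟩
  · obtain ⟨c, hbc, hc⟩ := exists_between hb
    have hctop : c ≠ ∞ := (hc.trans ENNReal.one_lt_top).ne
    have hc1 : c.toReal < 1 := by
      rw [← ENNReal.toReal_one]
      exact (ENNReal.toReal_lt_toReal hctop ENNReal.one_ne_top).2 hc
    filter_upwards [hv0, hv, hl c.toReal hc1] with β h0 htop h
    rw [ENNReal.ofReal_toReal hctop] at h
    exact hbc.trans_le ((ENNReal.le_div_iff_mul_le (Or.inl h0) (Or.inl htop)).2 h)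
  · obtain ⟨c, hc, hcb⟩ := exists_between hb
    have hctop : c ≠ ∞ := hcb.ne_top
    have hc1 : 1 < c.toReal := by
      rw [← ENNReal.toReal_one]
      exact (ENNReal.toReal_lt_toReal ENNReal.one_ne_top hctop).2 hc
    filter_upwards [hv0, hv, hu c.toReal hc1] with β h0 htop h
    rw [ENNReal.ofReal_toReal hctop] at h
    exact lt_of_le_of_lt ((ENNReal.div_le_iff h0 htop).2 h) hcb

lemma AsympEquiv.of_common {u u' v : ℝ → ℝ≥0∞}
    (hv0 : ∀ᶠ β in 𝓝[>] 0, v β ≠ 0) (hv : ∀ᶠ β in 𝓝[>] 0, v β ≠ ∞)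
    (h : AsympEquiv u v) (h' : AsympEquiv u' v) : AsympEquiv u u' := by
  have hdiv := ENNReal.Tendsto.div h (Or.inr one_ne_zero) h' (Or.inr ENNReal.one_ne_top)
  rw [div_one] at hdiv
  refine Tendsto.congr' ?_ hdiv
  filter_upwards [hv0, hv] with β h0 htop
  rw [div_eq_mul_inv (u β) (v β), div_eq_mul_inv (u' β) (v β),
    ENNReal.mul_div_mul_right _ _ (ENNReal.inv_ne_zero.2 htop) (ENNReal.inv_ne_top.2 h0)]

theorem mainTheorem1 {Ω 𝒳 Θ : Type*} [MeasurableSpace Ω] [MeasurableSpace 𝒳]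
    [MetricSpace Θ] [MeasurableSpace Θ] [BorelSpace Θ]
    (M : ChangePointModel Ω 𝒳 Θ)
    (W : Measure Θ) [IsProbabilityMeasure W]
    (hW : ∀ (θ : Θ) (δ : ℝ), 0 < δ → 0 < W (Metric.ball θ δ))
    (ϱ₁ δ ϱ₂ : ℝ → ℝ) (hrates : AdmissibleRates ϱ₁ δ) (hϱ₂ : ∀ β, ϱ₂ β = δ β * ϱ₁ β)
    (ℓ m : ℝ → ℕ) (hℓ : ∀ β, 0 < β → β < 1 → 1 ≤ ℓ β) (hm : ∀ β, 0 < β → β < 1 → 1 ≤ m β)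
    (α₂ : ℝ → ℝ) (hα₂ : ∀ β, α₂ β = alphaTwo β (ϱ₂ β) (ℓ β) (m β))
    (T : ℝ → Ω → ℕ∞) (hT : ∀ β, T β = M.wsrTime W (wsrThreshold (α₂ β) (ϱ₂ β)))
    (H1 : CondHOne ϱ₁ m) (H2 : CondHTwo ϱ₂ ℓ m) :
    (∀ β, 0 < β → β < 1 → T β ∈ M.localClass β (ℓ β) (m β)) ∧
    ∀ (I : Θ → ℝ) (r : ℝ), 1 ≤ r → M.RightTail I → M.LeftTail I r →
      ∀ (q : ℝ), 0 < q → q ≤ r → ∀ θ : Θ,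
        (∀ ν : ℕ,
          AsympEquiv (fun β => ⨅ τ ∈ M.localClass β (ℓ β) (m β), M.risk q ν θ τ)
            (fun β => ENNReal.ofReal ((|Real.log β| / I θ) ^ q)) ∧
          AsympEquiv (fun β => M.risk q ν θ (T β))
            (fun β => ENNReal.ofReal ((|Real.log β| / I θ) ^ q)) ∧
          AsympEquiv (fun β => M.risk q ν θ (T β))
            (fun β => ⨅ τ ∈ M.localClass β (ℓ β) (m β), M.risk q ν θ τ)) ∧
        AsympEquiv
          (fun β => ⨅ τ ∈ M.localClass β (ℓ β) (m β), ⨆ (ν : ℕ) (_ : ν ≤ ℓ β + m β), M.risk q ν θ τ)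
          (fun β => ENNReal.ofReal ((|Real.log β| / I θ) ^ q)) ∧
        AsympEquiv
          (fun β => ⨆ (ν : ℕ) (_ : ν ≤ ℓ β + m β), M.risk q ν θ (T β))
          (fun β => ENNReal.ofReal ((|Real.log β| / I θ) ^ q)) ∧
        AsympEquiv
          (fun β => ⨆ (ν : ℕ) (_ : ν ≤ ℓ β + m β), M.risk q ν θ (T β))
          (fun β => ⨅ τ ∈ M.localClass β (ℓ β) (m β),
            ⨆ (ν : ℕ) (_ : ν ≤ ℓ β + m β), M.risk q ν θ τ) := by
  obtain rfl : ϱ₂ = fun β => δ β * ϱ₁ β := funext hϱ₂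
  obtain rfl : α₂ = fun β => alphaTwo β (δ β * ϱ₁ β) (ℓ β) (m β) := funext hα₂
  have hmem : ∀ β, 0 < β → β < 1 → T β ∈ M.localClass β (ℓ β) (m β) := by
    intro β h0 h1
    obtain ⟨⟨hϱ0, hϱ1⟩, hδ0, hδ1⟩ := hrates.1 β h0 h1
    rw [hT β]
    exact M.wsrTime_mem_localClass W h0 h1 (mul_pos hδ0 hϱ0) (by nlinarith) _ _
  refine ⟨hmem, fun I r hr hright hleft q hq hqr θ => ?_⟩
  set v : ℝ → ℝ≥0∞ := fun β => ENNReal.ofReal ((|Real.log β| / I θ) ^ q)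
  have hv : ∀ᶠ β in 𝓝[>] 0, v β ≠ ∞ := Eventually.of_forall fun _ => ENNReal.ofReal_ne_top
  have hv0 : ∀ᶠ β in 𝓝[>] 0, v β ≠ 0 := by
    filter_upwards [eventually_mem_unit_interval] with β hβ
    have hL : 0 < |Real.log β| := abs_pos.2 (Real.log_neg hβ.1 hβ.2).ne
    have hI := (hright θ).1
    exact (ENNReal.ofReal_pos.2 (by positivity)).ne'
  have hlow : ∀ (ν : ℕ) (c : ℝ), c < 1 → ∀ᶠ β in 𝓝[>] 0, ∀ τ ∈ M.localClass β (ℓ β) (m β),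
      ENNReal.ofReal c * v β ≤ M.risk q ν θ τ := fun ν c hc =>
    M.eventually_mul_le_risk hrates hℓ H1 hright hq ν θ hc
  have hupp : ∀ c : ℝ, 1 < c → ∀ᶠ β in 𝓝[>] 0, ∀ ν ≤ ℓ β + m β,
      M.risk q ν θ (T β) ≤ ENNReal.ofReal c * v β := fun c hc => by
    filter_upwards [M.eventually_risk_wsrTime_le W hW hrates H2 hr hleft hq hqr θ hc] with β h
    rwa [hT β]
  -- Each fixed `ν` eventually lies in the range `ν ≤ ℓ + m`, so the uniform upper bound also serves
  -- the pointwise claim.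
  have hmν : ∀ ν : ℕ, ∀ᶠ β in 𝓝[>] 0, ν ≤ ℓ β + m β := by
    intro ν
    filter_upwards [CondHOne.eventually_mul_abs_log_le hrates H1 one_pos,
      tendsto_abs_log_atTop.eventually_ge_atTop (ν : ℝ)] with β h1 h2
    have : (ν : ℝ) ≤ m β := by linarith
    have : ν ≤ m β := by exact_mod_cast this
    omega
  have hT_mem : ∀ᶠ β in 𝓝[>] 0, T β ∈ M.localClass β (ℓ β) (m β) :=
    eventually_mem_unit_interval.mono fun β hβ => hmem β hβ.1 hβ.2
  -- For the maximal risk the lower bound at `ν = 0` suffices, as its leading term does not depend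
  -- on `ν`.
  have hsup_ge : ∀ β τ, M.risk q 0 θ τ ≤ ⨆ (ν : ℕ) (_ : ν ≤ ℓ β + m β), M.risk q ν θ τ :=
    fun β τ => le_iSup₂_of_le 0 (Nat.zero_le _) le_rfl
  have hpoint : ∀ ν : ℕ,
      AsympEquiv (fun β => ⨅ τ ∈ M.localClass β (ℓ β) (m β), M.risk q ν θ τ) v ∧
      AsympEquiv (fun β => M.risk q ν θ (T β)) v := by
    intro ν
    constructor <;> refine asympEquiv_of_eventually_le hv0 hv (fun c hc => ?_) fun c hc => ?_
    · exact (hlow ν c hc).mono fun β h => le_iInf₂ h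
    · filter_upwards [hupp c hc, hmν ν, hT_mem] with β h hν hTβ
      exact (iInf₂_le _ hTβ).trans (h ν hν)
    · filter_upwards [hlow ν c hc, hT_mem] with β h hTβ using h _ hTβ
    · filter_upwards [hupp c hc, hmν ν] with β h hν using h ν hν
  have hmax : AsympEquiv (fun β => ⨅ τ ∈ M.localClass β (ℓ β) (m β),
        ⨆ (ν : ℕ) (_ : ν ≤ ℓ β + m β), M.risk q ν θ τ) v ∧
      AsympEquiv (fun β => ⨆ (ν : ℕ) (_ : ν ≤ ℓ β + m β), M.risk q ν θ (T β)) v := by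
    constructor <;> refine asympEquiv_of_eventually_le hv0 hv (fun c hc => ?_) fun c hc => ?_
    · exact (hlow 0 c hc).mono fun β h => le_iInf₂ fun τ hτ => (h τ hτ).trans (hsup_ge β τ)
    · filter_upwards [hupp c hc, hT_mem] with β h hTβ
      exact (iInf₂_le _ hTβ).trans (iSup₂_le h)
    · filter_upwards [hlow 0 c hc, hT_mem] with β h hTβ
      exact (h _ hTβ).trans (hsup_ge β _)
    · exact (hupp c hc).mono fun β h => iSup₂_le h
  exact ⟨fun ν => ⟨(hpoint ν).1, (hpoint ν).2, (hpoint ν).2.of_common hv0 hv (hpoint ν).1⟩,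
    hmax.1, hmax.2, hmax.2.of_common hv0 hv hmax.1⟩
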